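/- Setting. There are $K\ge 1$ actions and $N\ge 1$ experts. An oblivious adversary fixes losses $\ell_{t,j}\in[0,1]$ ($j\in[K]$) and expert suggestions $E_{i,t}\in[K]$ ($i\in[N]$) for all rounds $t$ in advance. Let $L_T^*=\min_{i\in[N]}\sum_{t=1}^T\ell_{t,E_{i,t}}$. Algorithm. Let $\mathcal D$ be a probability distribution on $\mathbb R$ with finite mean, let $0\le\rho<1/K$, and let $\tilde\Phi(L)=\mathbb E[\min_{i}(L_i-Z_i)]$ for $L\in\mathbb R^N$, where $Z_1,\dots,Z_N$ are i.i.d. draws from $\mathcal D$. Put $\overline\phi_0=0\in\mathbb R^N$. In round $t=1,\dots,T$ set $p_t=\nabla\tilde\Phi(\overline\phi_{t-1})$, $q_{t,j}=\sum_{i:E_{i,t}=j}p_{t,i}$ and $\tilde q_t=C_\rho(q_t)$, where $[C_\rho(q)]_j=q_j/\bigl(1-\sum_{j':q_{j'}<\rho}q_{j'}\bigr)$ if $q_j\ge\rho$ and $[C_\rho(q)]_j=0$ otherwise (for $\rho=0$ there is no clipping and $\tilde q_t=q_t$). Sample $j_t\sim\tilde q_t$, observe $\ell_{t,j_t}$,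 and update $\overline\phi_{t,i}=\overline\phi_{t-1,i}+\frac{\ell_{t,j_t}}{\tilde q_{t,j_t}}\mathbf 1[E_{i,t}=j_t]$ for all $i\in[N]$. The expected regret is $\mathbb E\bigl[\sum_{t=1}^T\ell_{t,j_t}\bigr]-L_T^*$. Theorem. Consider any of the following families of distributions: Gamma (with shape and rate parameters), Gumbel (location and scale), Fréchet (shape $>1$ and scale), Weibull (scale and shape), Pareto (scale and shape $>1$). There is a constant $C$, depending only on the family, such that: 1. (No clipping.) For all $K,N\ge1$ and $T\ge 0$ there is a distribution $\mathcal D$ in the family such that $\tilde\Phi$ is well defined, concave and differentiable with $\nabla\tilde\Phi$ in the probability simplex of $\mathbb R^N$, and the algorithm with $\rho=0$ has expected regret at most $C\sqrt{KT\log N}$ for all losses and expert suggestions. 2. (Clipping.) For all $K,N\ge1$ and every real $L\ge 0$ there are a distribution $\mathcal D$ in the family, with $\tilde\Phi$ as in part 1, and a threshold $0<\rho<1/K$ such that, for every $T\ge 0$ and all losses and expert suggestions with $L_T^*=L$, the algorithm has expected regret at most $C\bigl((K\log N)^{1/3}(L_T^*)^{2/3}+K\log N\bigr)$. In particular, it is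 $O\bigl((K\log N)^{1/3}(L_T^*)^{2/3}\bigr)$ when $L_T^*\ge K\log N$. -/

import Mathlib

open MeasureTheory ProbabilityTheory

namespace BanditsWithExperts

/-! ### Perturbation distributions -/

/-- The five families of perturbation distributions. -/
inductive Family where
  | gamma
  | gumbel
  | frechet
  | weibull
  | pareto

/-- The Gumbel distribution with location `μ` and scale `β`, with distribution function
`exp (- exp (- (x - μ) / β))`. -/
noncomputable def gumbelMeasure (μ β : ℝ) : Measure ℝ :=
  volume.withDensity fun x =>
    ENNReal.ofReal (β⁻¹ * Real.exp (-((x - μ) / β + Real.exp (-((x - μ) / β)))))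

/-- The Fréchet distribution with shape `α` and scale `s`, with distribution function
`exp (- (x / s) ^ (-α))` on `x > 0`. -/
noncomputable def frechetMeasure (α s : ℝ) : Measure ℝ :=
  volume.withDensity fun x =>
    ENNReal.ofReal
      (if 0 < x then α / s * (x / s) ^ (-1 - α) * Real.exp (-(x / s) ^ (-α)) else 0)

/-- The Weibull distribution with scale `lam` and shape `k`, with distribution function
`1 - exp (- (x / lam) ^ k)` on `x > 0`. -/
noncomputable def weibullMeasure (lam k : ℝ) : Measure ℝ :=
  volume.withDensity fun x =>
    ENNReal.ofReal
      (if 0 < x then k / lam * (x / lam) ^ (k - 1) * Real.exp (-(x / lam) ^ k) else 0)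

/-- The distribution with parameters `a`, `b` in each family: Gamma(shape `a`, rate `b`),
Gumbel(location `a`, scale `b`), Fréchet(shape `a`, scale `b`), Weibull(scale `a`, shape `b`),
Pareto(scale `a`, shape `b`). -/
noncomputable def Family.dist : Family → ℝ → ℝ → Measure ℝ
  | .gamma, a, b => gammaMeasure a b
  | .gumbel, a, b => gumbelMeasure a b
  | .frechet, a, b => frechetMeasure a b
  | .weibull, a, b => weibullMeasure a b
  | .pareto, a, b => paretoMeasure a b

/-- The parameters for which the distribution is defined and has a finite mean. -/
def Family.Admissible : Family → ℝ → ℝ → Prop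
  | .gamma, a, b => 0 < a ∧ 0 < b
  | .gumbel, _, b => 0 < b
  | .frechet, a, b => 1 < a ∧ 0 < b
  | .weibull, a, b => 0 < a ∧ 0 < b
  | .pareto, a, b => 0 < a ∧ 1 < b

/-! ### The potential -/

/-- The follow-the-perturbed-leader potential `Φ(L) = 𝔼[min_i (L_i - Z_i)]`, where
`Z_1, …, Z_N` are i.i.d. with law `D`. -/
noncomputable def ftplPotential (N : ℕ) (D : Measure ℝ) (L : Fin N → ℝ) : ℝ :=
  ∫ z : Fin N → ℝ, ⨅ i, (L i - z i) ∂(Measure.pi fun _ => D)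

/-- The gradient of `Φ` at `L`, as the vector of partial derivatives. -/
noncomputable def grad {N : ℕ} (Φ : (Fin N → ℝ) → ℝ) (L : Fin N → ℝ) : Fin N → ℝ :=
  fun i => fderiv ℝ Φ L (Pi.single i 1)

/-- The requirement on the input of the algorithm: a concave differentiable potential, the
gradient of which takes its values in the probability simplex. -/
structure IsPotential {N : ℕ} (Φ : (Fin N → ℝ) → ℝ) : Prop where
  concave : ConcaveOn ℝ Set.univ Φ
  differentiable : Differentiable ℝ Φ
  grad_mem : ∀ L, grad Φ L ∈ stdSimplex ℝ (Fin N)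

/-- The perturbation law `D` is a probability measure for which the random variable
`min_i (L_i - Z_i)` in the potential is integrable, and the potential is a legitimate input of
the algorithm. -/
structure IsValidPerturbation (N : ℕ) (D : Measure ℝ) : Prop where
  isProbabilityMeasure : IsProbabilityMeasure D
  integrable : ∀ L : Fin N → ℝ,
    Integrable (fun z : Fin N → ℝ => ⨅ i, (L i - z i)) (Measure.pi fun _ => D)
  isPotential : IsPotential (ftplPotential N D)

/-! ### The algorithm -/

/-- The map `ψ` from weights on experts to weights on actions, for the advice `e`. -/
def toActions {N K : ℕ} (e : Fin N → Fin K) (p : Fin N → ℝ) : Fin K → ℝ :=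
  fun j => ∑ i with e i = j, p i

/-- The map `φ` from loss vectors on actions to loss vectors on experts, for the advice `e`. -/
def toExperts {N K : ℕ} (e : Fin N → Fin K) (v : Fin K → ℝ) : Fin N → ℝ :=
  fun i => v (e i)

/-- Clipping at the threshold `ρ`. -/
noncomputable def clip {K : ℕ} (ρ : ℝ) (q : Fin K → ℝ) : Fin K → ℝ :=
  fun j => if ρ ≤ q j then q j / (1 - ∑ j' with q j' < ρ, q j') else 0

/-- The threshold `0` means no clipping. -/
theorem clip_zero {K : ℕ} (q : Fin K → ℝ) (hq : ∀ j, 0 ≤ q j) : clip 0 q = q := by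
  have h : (Finset.univ.filter fun j => q j < 0) = ∅ :=
    Finset.filter_eq_empty_iff.mpr fun j _ => not_lt.mpr (hq j)
  funext j
  simp [clip, h, hq j]

/-- The distribution on the actions from which the algorithm samples, when the advice is `e` and
the cumulative loss estimate of the experts is `c`. -/
noncomputable def actionDist {N K : ℕ} (Φ : (Fin N → ℝ) → ℝ) (ρ : ℝ) (e : Fin N → Fin K)
    (c : Fin N → ℝ) : Fin K → ℝ :=
  clip ρ (toActions e (grad Φ c))

/-- The importance weighted loss estimate: `j` is the sampled action, `x` its observed loss and
`q` the sampling distribution. -/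
noncomputable def lossEstimate {K : ℕ} (q : Fin K → ℝ) (j : Fin K) (x : ℝ) : Fin K → ℝ :=
  Pi.single j (x / q j)

/-- The cumulative loss estimate of the experts after `t` rounds, in which the actions `a` were
sampled. `E s i` is the action suggested by expert `i`, and `ℓ s j` the loss of action `j`, in
round `s = 0, 1, …`. -/
noncomputable def cumEstimate {N K : ℕ} (Φ : (Fin N → ℝ) → ℝ) (ρ : ℝ)
    (E : ℕ → Fin N → Fin K) (ℓ : ℕ → Fin K → ℝ) : (t : ℕ) → (Fin t → Fin K) → Fin N → ℝ
  | 0, _ => 0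
  | t + 1, a =>
    let c := cumEstimate Φ ρ E ℓ t fun s => a s.castSucc
    let j := a (Fin.last t)
    c + toExperts (E t) (lossEstimate (actionDist Φ ρ (E t) c) j (ℓ t j))

/-- The probability that the actions sampled in the first `t` rounds are `a`. -/
noncomputable def trajProb {N K : ℕ} (Φ : (Fin N → ℝ) → ℝ) (ρ : ℝ)
    (E : ℕ → Fin N → Fin K) (ℓ : ℕ → Fin K → ℝ) : (t : ℕ) → (Fin t → Fin K) → ℝ
  | 0, _ => 1
  | t + 1, a =>
    let b : Fin t → Fin K := fun s => a s.castSucc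
    trajProb Φ ρ E ℓ t b * actionDist Φ ρ (E t) (cumEstimate Φ ρ E ℓ t b) (a (Fin.last t))

/-- The expected total loss of the algorithm in `T` rounds. -/
noncomputable def expectedLoss {N K : ℕ} (Φ : (Fin N → ℝ) → ℝ) (ρ : ℝ)
    (E : ℕ → Fin N → Fin K) (ℓ : ℕ → Fin K → ℝ) (T : ℕ) : ℝ :=
  ∑ a : Fin T → Fin K, trajProb Φ ρ E ℓ T a * ∑ t : Fin T, ℓ t (a t)

/-- The total loss of the best expert in `T` rounds. -/
noncomputable def bestLoss {N K : ℕ} (E : ℕ → Fin N → Fin K) (ℓ : ℕ → Fin K → ℝ) (T : ℕ) : ℝ :=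
  ⨅ i, ∑ t ∈ Finset.range T, ℓ t (E t i)

/-- The expected regret of the algorithm after `T` rounds, against fixed advice and losses. -/
noncomputable def expectedRegret {N K : ℕ} (Φ : (Fin N → ℝ) → ℝ) (ρ : ℝ)
    (E : ℕ → Fin N → Fin K) (ℓ : ℕ → Fin K → ℝ) (T : ℕ) : ℝ :=
  expectedLoss Φ ρ E ℓ T - bestLoss E ℓ T

end BanditsWithExperts

namespace BanditsWithExperts

/-! ### The gradient of the potential -/

/-! Everything rests on one property of the perturbation law: moving an event to the right by `s`
costs at most a factor `exp (-η s)`. The gradient of the potential at `c` gives the probability that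
expert `i` minimizes `c i - z i`. Raising `c` by `s` on all experts that recommend action `j` can be
offset by moving `z i` up by `s`, so the weight `q j` of that action falls at most by the same
factor (`exp_mul_toActions_le`). Integrating `exp (-η s) ≥ 1 - η s` bounds the growth of the
potential along such a direction below by `(t - η t² / 2) q j` (`ftplPotential_add_le`).

With `t = x j / r j`, where `r` is the sampling distribution, and averaged over `r`, the first-order
term is `q j * x j` and the second-order cost at most `η / 2 * x j`, because `q j ≤ r j` for
surviving actions (`potential_step`). Without clipping the cost is at most `η K / 2` per round. With
clipping `q j ≥ ρ`, so the cost becomes a relative loss `η / (2 ρ)`, beside a factor `1 - K ρ` for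
renormalizing. Summing over the rounds, and comparing the final potential with the best expert,
whose loss is not overestimated in expectation, leaves only `𝔼[max Z] - 𝔼[Z]` to be bounded.

This gap is `O(log N / η)` in every family. The exponential law (a Gamma and a Weibull law) and the
Gumbel law have tails of rate `η`; Pareto and Fréchet laws reach it with shape about `log N` and
scale about `log N / η`. Finally `η` is tuned to `√(log N / (K T))`, or, with clipping, `ρ = γ / K`
and `η = γ² / K` with `γ = (K log N / L)^(1/3)`. -/

/-- A probability law without atoms and with finite mean, the translates of which to the right by
`s` lose at most the factor `exp (- η * s)`. -/
structure IsSmoothLaw (D : Measure ℝ) (η : ℝ) : Prop where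
  isProbabilityMeasure : IsProbabilityMeasure D
  singleton : ∀ x, D {x} = 0
  integrable : Integrable (fun x => x) D
  shift : ∀ s, 0 ≤ s → ∀ A, MeasurableSet A →
    ENNReal.ofReal (Real.exp (-(η * s))) * D A ≤ D ((fun x => x - s) ⁻¹' A)

/-- Fubini with one coordinate split off, so that one-dimensional properties of `D` can be applied
to a single perturbation. -/
theorem pi_apply_insertNth {n : ℕ} (D : Measure ℝ) [IsProbabilityMeasure D] (i : Fin (n + 1))
    {A : Set (Fin (n + 1) → ℝ)} (hA : MeasurableSet A) :
    Measure.pi (fun _ : Fin (n + 1) => D) A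
      = ∫⁻ w, D ((fun x => (i.insertNth x w : Fin (n + 1) → ℝ)) ⁻¹' A)
          ∂(Measure.pi fun _ : Fin n => D) := by
  have h := (measurePreserving_piFinSuccAbove (fun _ : Fin (n + 1) => D) i).symm
  rw [← h.measure_preimage hA.nullMeasurableSet, Measure.prod_apply_symm]
  · rfl
  · exact (MeasurableEquiv.measurable _) hA

/-- The perturbations for which `i` is the strict minimizer of `L i - z i`. -/
def argminSet {N : ℕ} (L : Fin N → ℝ) (i : Fin N) : Set (Fin N → ℝ) :=
  {z | ∀ j, j ≠ i → L i - z i < L j - z j}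

theorem isOpen_argminSet {N : ℕ} (L : Fin N → ℝ) (i : Fin N) : IsOpen (argminSet L i) := by
  have : argminSet L i = ⋂ j, {z | j ≠ i → L i - z i < L j - z j} := by
    ext z; simp [argminSet]
  rw [this]
  refine isOpen_iInter_of_finite fun j => ?_
  by_cases h : j = i
  · simp [h]
  · simpa [h] using isOpen_lt (by fun_prop) (by fun_prop)

theorem measurableSet_argminSet {N : ℕ} (L : Fin N → ℝ) (i : Fin N) :
    MeasurableSet (argminSet L i) := (isOpen_argminSet L i).measurableSet

/-- Once the other perturbations are fixed, a tie pins `z i` to a single point, which is null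
because `D` has no atoms. -/
theorem ae_ne_of_ne {n : ℕ} {D : Measure ℝ} {η : ℝ} (hD : IsSmoothLaw D η)
    (L : Fin (n + 1) → ℝ) {i j : Fin (n + 1)} (hij : i ≠ j) :
    ∀ᵐ z ∂(Measure.pi fun _ : Fin (n + 1) => D), L i - z i ≠ L j - z j := by
  have := hD.isProbabilityMeasure
  have hm : MeasurableSet {z : Fin (n + 1) → ℝ | L i - z i = L j - z j} :=
    (isClosed_eq (by fun_prop) (by fun_prop)).measurableSet
  rw [ae_iff]
  simp only [ne_eq, not_not]
  rw [pi_apply_insertNth D i hm]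
  obtain ⟨k, rfl⟩ := Fin.exists_succAbove_eq hij.symm
  refine (lintegral_congr fun w => ?_).trans lintegral_zero
  refine measure_mono_null (fun x hx => ?_) (hD.singleton (L i - L (i.succAbove k) + w k))
  simp only [Set.mem_preimage, Set.mem_ofPred_eq, Fin.insertNth_apply_same,
    Fin.insertNth_apply_succAbove] at hx
  simp only [Set.mem_singleton_iff]
  linarith

theorem ae_mem_argminSet {n : ℕ} {D : Measure ℝ} {η : ℝ} (hD : IsSmoothLaw D η)
    (L : Fin (n + 1) → ℝ) :
    ∀ᵐ z ∂(Measure.pi fun _ : Fin (n + 1) => D), ∃ i, z ∈ argminSet L i := by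
  have h : ∀ᵐ z ∂(Measure.pi fun _ : Fin (n + 1) => D),
      ∀ i j, i ≠ j → L i - z i ≠ L j - z j := by
    rw [ae_all_iff]; intro i
    rw [ae_all_iff]; intro j
    by_cases hij : i = j
    · simp [hij]
    · simpa [hij] using ae_ne_of_ne hD L hij
  filter_upwards [h] with z hz
  obtain ⟨i, hi⟩ := Finite.exists_min fun i => L i - z i
  exact ⟨i, fun j hj => lt_of_le_of_ne (hi j) (hz i j hj.symm)⟩

theorem iInf_sub_eq_of_mem {n : ℕ} {L z : Fin (n + 1) → ℝ} {i : Fin (n + 1)}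
    (h : z ∈ argminSet L i) : ⨅ k, (L k - z k) = L i - z i := by
  refine le_antisymm (ciInf_le (Set.finite_range _).bddBelow i) (le_ciInf fun j => ?_)
  by_cases hj : j = i
  · rw [hj]
  · exact (h j hj).le

theorem sum_indicator_argminSet {n : ℕ} {L z : Fin (n + 1) → ℝ} {i : Fin (n + 1)}
    (h : z ∈ argminSet L i) {M : Type*} [AddCommMonoid M] (f : Fin (n + 1) → M) :
    ∑ k, (argminSet L k).indicator (fun _ => f k) z = f i := by
  rw [Finset.sum_eq_single i]
  · simp [h]
  · intro k _ hk
    refine Set.indicator_of_notMem (fun hz => ?_) _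
    exact lt_asymm (h k hk) (hz i hk.symm)
  · simp

theorem measurable_iInf_sub {n : ℕ} (L : Fin (n + 1) → ℝ) :
    Measurable fun z : Fin (n + 1) → ℝ => ⨅ i, (L i - z i) :=
  Measurable.iInf fun i => by fun_prop

theorem iInf_sub_le_add {n : ℕ} (L L' z : Fin (n + 1) → ℝ) :
    ⨅ i, (L i - z i) ≤ (⨅ i, (L' i - z i)) + ‖L - L'‖ := by
  obtain ⟨i, hi⟩ := exists_eq_ciInf_of_finite (f := fun i => L' i - z i)
  have h1 : ⨅ i, (L i - z i) ≤ L i - z i := ciInf_le (Set.finite_range _).bddBelow i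
  have h2 := (le_abs_self _).trans (norm_le_pi_norm (L - L') i)
  simp only [Pi.sub_apply] at h2
  linarith

theorem lipschitzWith_iInf_sub {n : ℕ} (z : Fin (n + 1) → ℝ) :
    LipschitzWith 1 fun L : Fin (n + 1) → ℝ => ⨅ i, (L i - z i) := by
  refine LipschitzWith.of_dist_le_mul fun L L' => ?_
  rw [NNReal.coe_one, one_mul, Real.dist_eq, abs_le, dist_eq_norm]
  have h1 := iInf_sub_le_add L L' z
  have h2 := iInf_sub_le_add L' L z
  rw [norm_sub_rev] at h2
  constructor <;> linarith

theorem integrable_eval {n : ℕ} {D : Measure ℝ} {η : ℝ} (hD : IsSmoothLaw D η)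
    (i : Fin (n + 1)) :
    Integrable (fun z : Fin (n + 1) → ℝ => z i) (Measure.pi fun _ => D) := by
  have := hD.isProbabilityMeasure
  exact (measurePreserving_eval (fun _ : Fin (n + 1) => D) i).integrable_comp_of_integrable
    hD.integrable

theorem integral_eval {n : ℕ} {D : Measure ℝ} [IsProbabilityMeasure D] (i : Fin (n + 1))
    {f : ℝ → ℝ} (hf : AEStronglyMeasurable f D) :
    ∫ z : Fin (n + 1) → ℝ, f (z i) ∂(Measure.pi fun _ => D) = ∫ x, f x ∂D := by
  have h := measurePreserving_eval (fun _ : Fin (n + 1) => D) i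
  rw [← h.map_eq] at hf
  refine (integral_map h.measurable.aemeasurable hf).symm.trans ?_
  rw [h.map_eq]

theorem integrable_iInf_sub {n : ℕ} {D : Measure ℝ} {η : ℝ} (hD : IsSmoothLaw D η)
    (L : Fin (n + 1) → ℝ) :
    Integrable (fun z : Fin (n + 1) → ℝ => ⨅ i, (L i - z i)) (Measure.pi fun _ => D) := by
  have := hD.isProbabilityMeasure
  have hi : ∀ i : Fin (n + 1), Integrable (fun z : Fin (n + 1) → ℝ => |L i - z i|)
      (Measure.pi fun _ => D) :=
    fun i => ((integrable_const _).sub (integrable_eval hD i)).abs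
  refine (integrable_finsetSum Finset.univ fun i _ => hi i).mono'
    (measurable_iInf_sub L).aestronglyMeasurable (ae_of_all _ fun z => ?_)
  obtain ⟨i, hi⟩ := exists_eq_ciInf_of_finite (f := fun i => L i - z i)
  rw [← hi, Real.norm_eq_abs]
  exact Finset.single_le_sum (f := fun i => |L i - z i|) (fun _ _ => abs_nonneg _)
    (Finset.mem_univ i)

theorem hasFDerivAt_iInf_sub {n : ℕ} {L z : Fin (n + 1) → ℝ} {i : Fin (n + 1)}
    (h : z ∈ argminSet L i) :
    HasFDerivAt (fun L : Fin (n + 1) → ℝ => ⨅ k, (L k - z k))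
      (ContinuousLinearMap.proj (R := ℝ) (φ := fun _ : Fin (n + 1) => ℝ) i) L := by
  have hopen : IsOpen {L' : Fin (n + 1) → ℝ | z ∈ argminSet L' i} := by
    have : {L' : Fin (n + 1) → ℝ | z ∈ argminSet L' i}
        = ⋂ j, {L' | j ≠ i → L' i - z i < L' j - z j} := by
      ext; simp [argminSet]
    rw [this]
    refine isOpen_iInter_of_finite fun j => ?_
    by_cases h : j = i
    · simp [h]
    · simpa [h] using isOpen_lt (by fun_prop) (by fun_prop)
  have h1 : HasFDerivAt (fun L : Fin (n + 1) → ℝ => L i - z i)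
      (ContinuousLinearMap.proj (R := ℝ) (φ := fun _ : Fin (n + 1) => ℝ) i) L :=
    (ContinuousLinearMap.proj (R := ℝ) (φ := fun _ : Fin (n + 1) => ℝ) i).hasFDerivAt.sub_const _
  refine h1.congr_of_eventuallyEq ?_
  filter_upwards [hopen.mem_nhds h] with L' hL'
  exact iInf_sub_eq_of_mem hL'

/-- Differentiation under the integral: the minimum is 1-Lipschitz in `L` and, off ties, locally
equal to the coordinate of its minimizer. The sum of indicators selects that coordinate. -/
theorem hasFDerivAt_ftplPotential {n : ℕ} {D : Measure ℝ} {η : ℝ} (hD : IsSmoothLaw D η)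
    (L : Fin (n + 1) → ℝ) :
    Integrable (fun z => ∑ i, (argminSet L i).indicator (fun _ =>
        ContinuousLinearMap.proj (R := ℝ) (φ := fun _ : Fin (n + 1) => ℝ) i) z)
        (Measure.pi fun _ => D) ∧
      HasFDerivAt (ftplPotential (n + 1) D)
      (∫ z, ∑ i, (argminSet L i).indicator (fun _ =>
        ContinuousLinearMap.proj (R := ℝ) (φ := fun _ : Fin (n + 1) => ℝ) i) z
        ∂(Measure.pi fun _ => D)) L := by
  have := hD.isProbabilityMeasure
  refine hasFDerivAt_integral_of_dominated_loc_of_lip (bound := fun _ => 1) (s := Set.univ)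
    Filter.univ_mem (Filter.Eventually.of_forall fun L =>
      (measurable_iInf_sub L).aestronglyMeasurable) (integrable_iInf_sub hD L) ?_ ?_
    (integrable_const _) ?_
  · refine Finset.aestronglyMeasurable_fun_sum _ fun i _ => ?_
    exact (stronglyMeasurable_const.indicator (measurableSet_argminSet L i)).aestronglyMeasurable
  · refine ae_of_all _ fun z => ?_
    simpa only [map_one] using (lipschitzWith_iInf_sub z).lipschitzOnWith
  · filter_upwards [ae_mem_argminSet hD L] with z ⟨i, hi⟩
    rw [sum_indicator_argminSet hi]
    exact hasFDerivAt_iInf_sub hi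

theorem grad_ftplPotential {n : ℕ} {D : Measure ℝ} {η : ℝ} (hD : IsSmoothLaw D η)
    (L : Fin (n + 1) → ℝ) (i : Fin (n + 1)) :
    grad (ftplPotential (n + 1) D) L i
      = (Measure.pi fun _ : Fin (n + 1) => D).real (argminSet L i) := by
  obtain ⟨hint, hd⟩ := hasFDerivAt_ftplPotential hD L
  rw [grad, hd.fderiv, ContinuousLinearMap.integral_apply hint,
    ← integral_indicator_one (measurableSet_argminSet L i)]
  refine integral_congr_ae ?_
  filter_upwards [ae_mem_argminSet hD L] with z ⟨k, hk⟩
  rw [sum_indicator_argminSet hk]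
  by_cases hki : k = i
  · subst hki; simp [hk]
  · have : z ∉ argminSet L i := fun hz => lt_asymm (hk i (Ne.symm hki)) (hz k hki)
    simp [this, hki]

theorem grad_ftplPotential_mem {n : ℕ} {D : Measure ℝ} {η : ℝ} (hD : IsSmoothLaw D η)
    (L : Fin (n + 1) → ℝ) :
    grad (ftplPotential (n + 1) D) L ∈ stdSimplex ℝ (Fin (n + 1)) := by
  have := hD.isProbabilityMeasure
  refine ⟨fun i => ?_, ?_⟩
  · rw [grad_ftplPotential hD]; exact measureReal_nonneg
  · simp_rw [grad_ftplPotential hD, ← integral_indicator_one (measurableSet_argminSet L _)]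
    rw [← integral_finsetSum]
    · have : ∫ _z : Fin (n + 1) → ℝ, (1 : ℝ) ∂(Measure.pi fun _ => D) = 1 := by simp
      rw [← this]
      refine integral_congr_ae ?_
      filter_upwards [ae_mem_argminSet hD L] with z ⟨k, hk⟩
      exact sum_indicator_argminSet hk fun _ => (1 : ℝ)
    · exact fun i _ => (integrable_const (1 : ℝ)).indicator (measurableSet_argminSet L i)

theorem concaveOn_ftplPotential {n : ℕ} {D : Measure ℝ} {η : ℝ} (hD : IsSmoothLaw D η) :
    ConcaveOn ℝ Set.univ (ftplPotential (n + 1) D) := by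
  refine ⟨convex_univ, fun L _ L' _ a b ha hb hab => ?_⟩
  simp only [ftplPotential, smul_eq_mul]
  rw [← integral_const_mul, ← integral_const_mul, ← integral_add]
  · refine integral_mono (((integrable_iInf_sub hD L).const_mul a).add
      ((integrable_iInf_sub hD L').const_mul b)) (integrable_iInf_sub hD _) fun z => ?_
    refine le_ciInf fun i => ?_
    have h1 : ⨅ i, (L i - z i) ≤ L i - z i := ciInf_le (Set.finite_range _).bddBelow i
    have h2 : ⨅ i, (L' i - z i) ≤ L' i - z i := ciInf_le (Set.finite_range _).bddBelow i
    have h3 := mul_le_mul_of_nonneg_left h1 ha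
    have h4 := mul_le_mul_of_nonneg_left h2 hb
    simp only [Pi.add_apply, Pi.smul_apply, smul_eq_mul]
    calc _ ≤ a * (L i - z i) + b * (L' i - z i) := add_le_add h3 h4
      _ = _ := by linear_combination (-z i) * hab
  · exact (integrable_iInf_sub hD L).const_mul a
  · exact (integrable_iInf_sub hD L').const_mul b

theorem IsSmoothLaw.isValidPerturbation {n : ℕ} {D : Measure ℝ} {η : ℝ} (hD : IsSmoothLaw D η) :
    IsValidPerturbation (n + 1) D where
  isProbabilityMeasure := hD.isProbabilityMeasure
  integrable := integrable_iInf_sub hD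
  isPotential :=
    { concave := concaveOn_ftplPotential hD
      differentiable := fun L => (hasFDerivAt_ftplPotential hD L).2.differentiableAt
      grad_mem := grad_ftplPotential_mem hD }

theorem ftplPotential_le {n : ℕ} {D : Measure ℝ} {η : ℝ} (hD : IsSmoothLaw D η)
    (L : Fin (n + 1) → ℝ) (i : Fin (n + 1)) :
    ftplPotential (n + 1) D L ≤ L i - ∫ x, x ∂D := by
  have := hD.isProbabilityMeasure
  have h : L i - ∫ x, x ∂D = ∫ z : Fin (n + 1) → ℝ, (L i - z i) ∂(Measure.pi fun _ => D) := by
    rw [integral_sub (integrable_const _) (integrable_eval hD i),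
      integral_eval i hD.integrable.aestronglyMeasurable]
    simp
  rw [h]
  exact integral_mono (integrable_iInf_sub hD L)
    ((integrable_const _).sub (integrable_eval hD i))
    fun z => ciInf_le (Set.finite_range _).bddBelow i

/-! ### Stability of the gradient -/

/-- The shift property of `D`, applied on each line parallel to the `i`-th axis. -/
theorem exp_mul_pi_le {n : ℕ} {D : Measure ℝ} {η : ℝ} (hD : IsSmoothLaw D η) (i : Fin (n + 1))
    {s : ℝ} (hs : 0 ≤ s) {A B : Set (Fin (n + 1) → ℝ)} (hA : MeasurableSet A)
    (hB : MeasurableSet B)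
    (h : ∀ x w, (i.insertNth (x - s) w : Fin (n + 1) → ℝ) ∈ A →
      (i.insertNth x w : Fin (n + 1) → ℝ) ∈ B) :
    Real.exp (-(η * s)) * (Measure.pi fun _ : Fin (n + 1) => D).real A
      ≤ (Measure.pi fun _ : Fin (n + 1) => D).real B := by
  have := hD.isProbabilityMeasure
  have key : ENNReal.ofReal (Real.exp (-(η * s))) * (Measure.pi fun _ : Fin (n + 1) => D) A
      ≤ (Measure.pi fun _ : Fin (n + 1) => D) B := by
    rw [pi_apply_insertNth D i hA, pi_apply_insertNth D i hB,
      ← lintegral_const_mul' _ _ ENNReal.ofReal_ne_top]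
    refine lintegral_mono fun w => ?_
    have hm : Measurable fun x => (i.insertNth x w : Fin (n + 1) → ℝ) := by
      refine measurable_pi_iff.2 fun k => ?_
      refine Fin.succAboveCases i ?_ (fun j => ?_) k
      · simpa using measurable_id'
      · simp
    exact (hD.shift s hs _ (hm hA)).trans (measure_mono fun x hx => h x w hx)
  have := ENNReal.toReal_mono (measure_ne_top _ _) key
  rwa [ENNReal.toReal_mul, ENNReal.toReal_ofReal (Real.exp_nonneg _)] at this

theorem exp_mul_grad_le {n K : ℕ} {D : Measure ℝ} {η : ℝ} (hD : IsSmoothLaw D η)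
    (e : Fin (n + 1) → Fin K) (c : Fin (n + 1) → ℝ) {s : ℝ} (hs : 0 ≤ s) (i : Fin (n + 1)) :
    Real.exp (-(η * s)) * grad (ftplPotential (n + 1) D) c i
      ≤ grad (ftplPotential (n + 1) D) (c + toExperts e (Pi.single (e i) s)) i := by
  rw [grad_ftplPotential hD, grad_ftplPotential hD]
  refine exp_mul_pi_le hD i hs (measurableSet_argminSet _ _) (measurableSet_argminSet _ _) ?_
  intro x w h j hj
  have h1 := h j hj
  obtain ⟨k, rfl⟩ := Fin.exists_succAbove_eq hj
  -- The entry of `i` rises by exactly `s`, which the shift of `z i` cancels; every competitor's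
  -- entry rises by at least `0`.
  have h2 : 0 ≤ toExperts e (Pi.single (e i) s) (i.succAbove k) := by
    simp only [toExperts, Pi.single_apply]
    split_ifs <;> simp [hs]
  simp only [Fin.insertNth_apply_same, Fin.insertNth_apply_succAbove, Pi.add_apply] at h1 ⊢
  have h3 : toExperts e (Pi.single (e i) s) i = s := by simp [toExperts]
  rw [h3]
  linarith

theorem exp_mul_toActions_le {n K : ℕ} {D : Measure ℝ} {η : ℝ} (hD : IsSmoothLaw D η)
    (e : Fin (n + 1) → Fin K) (c : Fin (n + 1) → ℝ) {s : ℝ} (hs : 0 ≤ s) (j : Fin K) :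
    Real.exp (-(η * s)) * toActions e (grad (ftplPotential (n + 1) D) c) j
      ≤ toActions e (grad (ftplPotential (n + 1) D) (c + toExperts e (Pi.single j s))) j := by
  rw [toActions, toActions, Finset.mul_sum]
  refine Finset.sum_le_sum fun i hi => ?_
  obtain rfl := (Finset.mem_filter.1 hi).2
  exact exp_mul_grad_le hD e c hs i

theorem hasDerivAt_ftplPotential_line {n K : ℕ} {D : Measure ℝ} {η : ℝ} (hD : IsSmoothLaw D η)
    (e : Fin (n + 1) → Fin K) (c : Fin (n + 1) → ℝ) (j : Fin K) (s : ℝ) :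
    HasDerivAt (fun s => ftplPotential (n + 1) D (c + toExperts e (Pi.single j s)))
      (toActions e (grad (ftplPotential (n + 1) D) (c + toExperts e (Pi.single j s))) j) s := by
  set v : Fin (n + 1) → ℝ := toExperts e (Pi.single j 1) with hv
  have hline : ∀ s : ℝ, c + toExperts e (Pi.single j s) = c + s • v := fun s => by
    ext i
    simp [hv, toExperts, Pi.single_apply]
  have h1 : HasDerivAt (fun s : ℝ => c + s • v) v s := by
    simpa using ((hasDerivAt_id s).smul_const v).const_add c
  have h2 := ((hasFDerivAt_ftplPotential hD (c + s • v)).2.differentiableAt.hasFDerivAt).comp_hasDerivAt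
    s h1
  simp_rw [hline]
  refine h2.congr_deriv ?_
  have hsum : v = ∑ i with e i = j, Pi.single i (1 : ℝ) := by
    ext k
    simp [hv, toExperts, Finset.sum_apply, Pi.single_apply, Finset.sum_ite_eq]
  rw [hsum, map_sum]
  rfl

theorem ftplPotential_add_le {n K : ℕ} {D : Measure ℝ} {η : ℝ} (hD : IsSmoothLaw D η)
    (e : Fin (n + 1) → Fin K) (c : Fin (n + 1) → ℝ) (j : Fin K) {t : ℝ} (ht : 0 ≤ t) :
    ftplPotential (n + 1) D c
        + (t - η / 2 * t ^ 2) * toActions e (grad (ftplPotential (n + 1) D) c) j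
      ≤ ftplPotential (n + 1) D (c + toExperts e (Pi.single j t)) := by
  set q := toActions e (grad (ftplPotential (n + 1) D) c) j with hq
  have hq0 : 0 ≤ q := Finset.sum_nonneg fun i _ => (grad_ftplPotential_mem hD c).1 i
  -- The derivative of `g` is the current weight of `j` minus `(1 - η s) q`, nonnegative by the
  -- stability bound and `1 + u ≤ exp u`.
  let g : ℝ → ℝ := fun s =>
    ftplPotential (n + 1) D (c + toExperts e (Pi.single j s)) - (s - η / 2 * s ^ 2) * q
  have hg : ∀ s, HasDerivAt g
      (toActions e (grad (ftplPotential (n + 1) D) (c + toExperts e (Pi.single j s))) j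
        - (1 - η * s) * q) s := fun s => by
    have h1 : HasDerivAt (fun s : ℝ => (s - η / 2 * s ^ 2) * q) ((1 - η * s) * q) s := by
      have := ((hasDerivAt_id s).sub (((hasDerivAt_id s).pow 2).const_mul (η / 2))).mul_const q
      refine this.congr_deriv ?_
      simp only [id]; ring
    exact (hasDerivAt_ftplPotential_line hD e c j s).sub h1
  have hmono : MonotoneOn g (Set.Ici 0) := by
    refine monotoneOn_of_deriv_nonneg (convex_Ici 0)
      (fun s _ => (hg s).continuousAt.continuousWithinAt)
      (fun s _ => (hg s).differentiableAt.differentiableWithinAt) fun s hs => ?_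
    rw [interior_Ici] at hs
    rw [(hg s).deriv, sub_nonneg]
    refine le_trans ?_ (exp_mul_toActions_le hD e c (le_of_lt hs) j)
    refine mul_le_mul_of_nonneg_right ?_ hq0
    have := Real.add_one_le_exp (-(η * s))
    linarith
  have h := hmono (Set.mem_Ici.2 le_rfl) (Set.mem_Ici.2 ht) ht
  have h0 : c + toExperts e (Pi.single j (0 : ℝ)) = c := by
    ext i; simp [toExperts]
  simp only [g, h0] at h
  linarith

/-! ### The sampling distribution -/

theorem toActions_mem {N K : ℕ} (e : Fin N → Fin K) {p : Fin N → ℝ}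
    (hp : p ∈ stdSimplex ℝ (Fin N)) : toActions e p ∈ stdSimplex ℝ (Fin K) := by
  refine ⟨fun j => Finset.sum_nonneg fun i _ => hp.1 i, ?_⟩
  rw [← hp.2]
  exact Finset.sum_fiberwise Finset.univ e p

theorem sum_clipped_le {K : ℕ} {ρ : ℝ} (hρ : 0 ≤ ρ) (q : Fin K → ℝ) :
    ∑ j with q j < ρ, q j ≤ K * ρ := by
  calc ∑ j with q j < ρ, q j ≤ ∑ j with q j < ρ, ρ :=
        Finset.sum_le_sum fun j hj => (Finset.mem_filter.1 hj).2.le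
    _ ≤ ∑ _j : Fin K, ρ :=
        Finset.sum_le_sum_of_subset_of_nonneg (Finset.filter_subset _ _) fun _ _ _ => hρ
    _ = K * ρ := by simp

theorem clip_nonneg {K : ℕ} {ρ : ℝ} (hρ : 0 ≤ ρ) (hρK : K * ρ < 1) (q : Fin K → ℝ) (j : Fin K) :
    0 ≤ clip ρ q j := by
  have := sum_clipped_le hρ q
  rw [clip]
  split_ifs with h
  · exact div_nonneg (hρ.trans h) (by linarith)
  · exact le_rfl

theorem sum_clip {K : ℕ} {ρ : ℝ} (hρ : 0 ≤ ρ) (hρK : K * ρ < 1) {q : Fin K → ℝ}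
    (hq : q ∈ stdSimplex ℝ (Fin K)) : ∑ j, clip ρ q j = 1 := by
  have h1 := sum_clipped_le hρ q
  have h2 : ∑ j with ¬ q j < ρ, q j = 1 - ∑ j with q j < ρ, q j := by
    have := Finset.sum_filter_add_sum_filter_not Finset.univ (fun j => q j < ρ) q
    rw [hq.2] at this
    linarith
  simp only [clip]
  rw [← Finset.sum_filter, ← Finset.sum_div]
  simp_rw [← not_lt]
  rw [h2]
  exact div_self (by linarith)

/-- Survivors are divided by a number at most `1`. This keeps the ratio of `q j` to its sampling
probability below `1` in the second-order term. -/
theorem le_clip {K : ℕ} {ρ : ℝ} (hρ : 0 ≤ ρ) (hρK : K * ρ < 1) {q : Fin K → ℝ}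
    (hq : q ∈ stdSimplex ℝ (Fin K)) {j : Fin K} (hj : ρ ≤ q j) : q j ≤ clip ρ q j := by
  have h1 := sum_clipped_le hρ q
  have h2 : 0 ≤ ∑ j with q j < ρ, q j := Finset.sum_nonneg fun i _ => hq.1 i
  rw [clip, if_pos hj, le_div_iff₀ (by linarith)]
  nlinarith [hq.1 j]

/-! ### Recursion over the rounds -/

section Trajectories

variable {N K : ℕ} {Φ : (Fin N → ℝ) → ℝ} {ρ : ℝ} (E : ℕ → Fin N → Fin K) (ℓ : ℕ → Fin K → ℝ)

theorem sum_trajProb_succ (t : ℕ) (F : (Fin (t + 1) → Fin K) → ℝ) :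
    ∑ a, trajProb Φ ρ E ℓ (t + 1) a * F a
      = ∑ b, trajProb Φ ρ E ℓ t b *
        ∑ j, actionDist Φ ρ (E t) (cumEstimate Φ ρ E ℓ t b) j
          * F (Fin.snoc (α := fun _ => Fin K) b j) := by
  rw [← (Fin.snocEquiv fun _ => Fin K).sum_comp, Fintype.sum_prod_type_right]
  refine Finset.sum_congr rfl fun b _ => ?_
  rw [Finset.mul_sum]
  refine Finset.sum_congr rfl fun j _ => ?_
  simp [Fin.snocEquiv, trajProb, mul_assoc]

theorem cumEstimate_snoc (t : ℕ) (b : Fin t → Fin K) (j : Fin K) :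
    cumEstimate Φ ρ E ℓ (t + 1) (Fin.snoc (α := fun _ => Fin K) b j)
      = cumEstimate Φ ρ E ℓ t b + toExperts (E t)
        (lossEstimate (actionDist Φ ρ (E t) (cumEstimate Φ ρ E ℓ t b)) j (ℓ t j)) := by
  simp [cumEstimate]

theorem actionDist_nonneg (hρ : 0 ≤ ρ) (hρK : K * ρ < 1) (e : Fin N → Fin K) (c : Fin N → ℝ)
    (j : Fin K) : 0 ≤ actionDist Φ ρ e c j := clip_nonneg hρ hρK _ j

theorem trajProb_nonneg (hρ : 0 ≤ ρ) (hρK : K * ρ < 1) (t : ℕ) (a : Fin t → Fin K) :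
    0 ≤ trajProb Φ ρ E ℓ t a := by
  induction t with
  | zero => simp [trajProb]
  | succ t ih => exact mul_nonneg (ih _) (actionDist_nonneg hρ hρK _ _ _)

variable (hΦ : ∀ c, grad Φ c ∈ stdSimplex ℝ (Fin N)) (hρ : 0 ≤ ρ) (hρK : K * ρ < 1)
include hΦ hρ hρK

theorem sum_actionDist (e : Fin N → Fin K) (c : Fin N → ℝ) :
    ∑ j, actionDist Φ ρ e c j = 1 := sum_clip hρ hρK (toActions_mem e (hΦ c))

theorem sum_trajProb (t : ℕ) : ∑ a, trajProb Φ ρ E ℓ t a = 1 := by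
  induction t with
  | zero => simp [trajProb]
  | succ t ih =>
    have := sum_trajProb_succ (Φ := Φ) (ρ := ρ) E ℓ t fun _ => 1
    simpa only [mul_one, sum_actionDist hΦ hρ hρK, ih] using this

theorem expectedLoss_succ (t : ℕ) :
    expectedLoss Φ ρ E ℓ (t + 1) = expectedLoss Φ ρ E ℓ t
      + ∑ b, trajProb Φ ρ E ℓ t b *
        ∑ j, actionDist Φ ρ (E t) (cumEstimate Φ ρ E ℓ t b) j * ℓ t j := by
  rw [expectedLoss, expectedLoss, sum_trajProb_succ, ← Finset.sum_add_distrib]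
  refine Finset.sum_congr rfl fun b _ => ?_
  rw [← mul_add]
  congr 1
  simp only [Fin.sum_univ_castSucc (n := t), Fin.snoc_castSucc, Fin.snoc_last, Fin.val_castSucc,
    Fin.val_last, mul_add]
  rw [Finset.sum_add_distrib, ← Finset.sum_mul, sum_actionDist hΦ hρ hρK, one_mul]

/-- A lower bound on the growth of the potential in one round gives a lower bound on its
expectation at the end. -/
theorem le_sum_trajProb_potential {κ β : ℝ} (hℓ : ∀ t j, ℓ t j ∈ Set.Icc (0 : ℝ) 1)
    (hstep : ∀ (e : Fin N → Fin K) (c : Fin N → ℝ) (x : Fin K → ℝ),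
      (∀ j, x j ∈ Set.Icc (0 : ℝ) 1) →
      Φ c + κ * ∑ j, actionDist Φ ρ e c j * x j - β
        ≤ ∑ j, actionDist Φ ρ e c j
          * Φ (c + toExperts e (lossEstimate (actionDist Φ ρ e c) j (x j)))) (T : ℕ) :
    Φ 0 + κ * expectedLoss Φ ρ E ℓ T - β * T
      ≤ ∑ a, trajProb Φ ρ E ℓ T a * Φ (cumEstimate Φ ρ E ℓ T a) := by
  induction T with
  | zero => simp [expectedLoss, trajProb, cumEstimate]
  | succ t ih =>
    rw [sum_trajProb_succ, expectedLoss_succ E ℓ hΦ hρ hρK]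
    simp only [cumEstimate_snoc]
    have h := Finset.sum_le_sum fun b (_ : b ∈ Finset.univ) =>
      mul_le_mul_of_nonneg_left (hstep (E t) (cumEstimate Φ ρ E ℓ t b) (ℓ t) (hℓ t))
        (trajProb_nonneg (Φ := Φ) E ℓ hρ hρK t b)
    refine le_trans ?_ h
    simp only [mul_sub, mul_add, Finset.sum_sub_distrib, Finset.sum_add_distrib,
      ← Finset.sum_mul, sum_trajProb E ℓ hΦ hρ hρK, one_mul]
    simp only [mul_left_comm _ κ, ← Finset.mul_sum]
    push_cast
    linarith

/-- The loss estimates do not overestimate. -/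
theorem sum_trajProb_cumEstimate_le (hℓ : ∀ t j, ℓ t j ∈ Set.Icc (0 : ℝ) 1) (T : ℕ) (i : Fin N) :
    ∑ a, trajProb Φ ρ E ℓ T a * cumEstimate Φ ρ E ℓ T a i
      ≤ ∑ t ∈ Finset.range T, ℓ t (E t i) := by
  induction T with
  | zero => simp [trajProb, cumEstimate]
  | succ t ih =>
    rw [sum_trajProb_succ, Finset.sum_range_succ]
    simp only [cumEstimate_snoc]
    have h : ∀ b, trajProb Φ ρ E ℓ t b * ∑ j, actionDist Φ ρ (E t) (cumEstimate Φ ρ E ℓ t b) j *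
        (cumEstimate Φ ρ E ℓ t b + toExperts (E t)
        (lossEstimate (actionDist Φ ρ (E t) (cumEstimate Φ ρ E ℓ t b)) j (ℓ t j))) i
        ≤ trajProb Φ ρ E ℓ t b * cumEstimate Φ ρ E ℓ t b i
          + trajProb Φ ρ E ℓ t b * ℓ t (E t i) := fun b => by
      rw [← mul_add]
      refine mul_le_mul_of_nonneg_left ?_ (trajProb_nonneg E ℓ hρ hρK t b)
      set q := actionDist Φ ρ (E t) (cumEstimate Φ ρ E ℓ t b) with hq
      simp only [Pi.add_apply, mul_add, Finset.sum_add_distrib, ← Finset.sum_mul]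
      rw [hq, sum_actionDist hΦ hρ hρK, one_mul, ← hq]
      gcongr
      rw [Finset.sum_eq_single (E t i)]
      · simp only [toExperts, lossEstimate, Pi.single_eq_same]
        -- The estimate is unbiased for actions of positive probability; an action that is never
        -- sampled contributes `0`, whence only an inequality.
        rcases eq_or_ne (q (E t i)) 0 with h0 | h0
        · simpa [h0] using (hℓ t (E t i)).1
        · rw [mul_div_cancel₀ _ h0]
      · intro j _ hj
        simp [toExperts, lossEstimate, hj.symm]
      · simp
    refine (Finset.sum_le_sum fun b _ => h b).trans ?_
    rw [Finset.sum_add_distrib, ← Finset.sum_mul, sum_trajProb E ℓ hΦ hρ hρK, one_mul]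
    gcongr

end Trajectories

/-! ### Regret in terms of the potential -/

section Regret

variable {n K : ℕ} {D : Measure ℝ} {η ρ : ℝ}

/-- The growth of the potential in one round. -/
theorem potential_step (hD : IsSmoothLaw D η) (hρ : 0 ≤ ρ) (hρK : K * ρ < 1)
    (e : Fin (n + 1) → Fin K) (c : Fin (n + 1) → ℝ) {x : Fin K → ℝ}
    (hx : ∀ j, x j ∈ Set.Icc (0 : ℝ) 1) (hη : 0 ≤ η) :
    ftplPotential (n + 1) D c
      + ∑ j with ρ ≤ toActions e (grad (ftplPotential (n + 1) D) c) j,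
        (toActions e (grad (ftplPotential (n + 1) D) c) j * x j - η / 2 * x j)
      ≤ ∑ j, actionDist (ftplPotential (n + 1) D) ρ e c j * ftplPotential (n + 1) D
          (c + toExperts e (lossEstimate (actionDist (ftplPotential (n + 1) D) ρ e c) j (x j))) := by
  have hΦ := grad_ftplPotential_mem (n := n) hD
  set Φ := ftplPotential (n + 1) D with hΦdef
  set q := toActions e (grad Φ c) with hq
  have hqs : q ∈ stdSimplex ℝ (Fin K) := toActions_mem e (hΦ c)
  have hsum := sum_actionDist hΦ hρ hρK e c
  calc Φ c + ∑ j with ρ ≤ q j, (q j * x j - η / 2 * x j)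
      = ∑ j, (actionDist Φ ρ e c j * Φ c
          + if ρ ≤ q j then q j * x j - η / 2 * x j else 0) := by
        rw [Finset.sum_add_distrib, ← Finset.sum_mul, hsum, one_mul, Finset.sum_filter]
    _ ≤ _ := Finset.sum_le_sum fun j _ => ?_
  set r := actionDist Φ ρ e c j with hr
  have hr0 : 0 ≤ r := actionDist_nonneg hρ hρK e c j
  have hadd := ftplPotential_add_le hD e c j (div_nonneg (hx j).1 hr0)
  rw [← hΦdef, ← hq] at hadd
  have h := mul_le_mul_of_nonneg_left hadd hr0
  refine le_trans ?_ h
  rw [mul_add]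
  gcongr
  split_ifs with hj
  · have hqr : q j ≤ r := le_clip hρ hρK hqs hj
    -- If `r = 0` then `x j / r` is `0` by convention and `q j` vanishes too, so only `-η / 2 * x j
    -- ≤ 0` is needed.
    rcases hr0.eq_or_lt with h0 | h0
    · have hq0 : q j = 0 := le_antisymm (h0 ▸ hqr) (hqs.1 j)
      rw [← h0, hq0]
      have := mul_nonneg hη (hx j).1
      simp only [zero_mul, zero_sub]
      linarith
    · have e1 : r * ((x j / r - η / 2 * (x j / r) ^ 2) * q j)
          = q j * x j - η / 2 * (x j * (x j * (q j / r))) := by field_simp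
      rw [e1]
      have h1 : q j / r ≤ 1 := (div_le_one h0).2 hqr
      have h2 : x j * (q j / r) ≤ 1 :=
        mul_le_one₀ (hx j).2 (div_nonneg (hqs.1 j) hr0) h1
      have h3 : x j * (x j * (q j / r)) ≤ x j := mul_le_of_le_one_right (hx j).1 h2
      have := mul_le_mul_of_nonneg_left h3 (by positivity : (0 : ℝ) ≤ η / 2)
      linarith
  · have : r = 0 := by rw [hr, actionDist, clip, ← hq, if_neg hj]
    simp [this]

theorem sum_trajProb_potential_le (hD : IsSmoothLaw D η) (hρ : 0 ≤ ρ) (hρK : K * ρ < 1)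
    (E : ℕ → Fin (n + 1) → Fin K) (ℓ : ℕ → Fin K → ℝ) (hℓ : ∀ t j, ℓ t j ∈ Set.Icc (0 : ℝ) 1)
    (T : ℕ) :
    ∑ a, trajProb (ftplPotential (n + 1) D) ρ E ℓ T a
        * ftplPotential (n + 1) D (cumEstimate (ftplPotential (n + 1) D) ρ E ℓ T a)
      ≤ bestLoss E ℓ T - ∫ x, x ∂D := by
  have hΦ := grad_ftplPotential_mem (n := n) hD
  obtain ⟨i, hi⟩ := exists_eq_ciInf_of_finite
    (f := fun i : Fin (n + 1) => ∑ t ∈ Finset.range T, ℓ t (E t i))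
  rw [bestLoss, ← hi]
  refine le_trans (Finset.sum_le_sum fun a _ => mul_le_mul_of_nonneg_left
    (ftplPotential_le hD _ i) (trajProb_nonneg E ℓ hρ hρK T a)) ?_
  simp only [mul_sub, Finset.sum_sub_distrib, ← Finset.sum_mul]
  rw [sum_trajProb E ℓ hΦ hρ hρK, one_mul]
  gcongr
  exact sum_trajProb_cumEstimate_le E ℓ hΦ hρ hρK hℓ T i

theorem expectedRegret_le (hD : IsSmoothLaw D η) (hη : 0 ≤ η)
    (E : ℕ → Fin (n + 1) → Fin K) (ℓ : ℕ → Fin K → ℝ)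
    (hℓ : ∀ t j, ℓ t j ∈ Set.Icc (0 : ℝ) 1) (T : ℕ) :
    expectedRegret (ftplPotential (n + 1) D) 0 E ℓ T
      ≤ -(∫ x, x ∂D) - ftplPotential (n + 1) D 0 + η / 2 * K * T := by
  have hΦ := grad_ftplPotential_mem (n := n) hD
  have hK0 : (K : ℝ) * 0 < 1 := by simp
  have h := le_sum_trajProb_potential E ℓ hΦ le_rfl hK0 (κ := 1) (β := η / 2 * K) hℓ
    (fun e c x hx => ?_) T
  · have h2 := sum_trajProb_potential_le hD le_rfl hK0 E ℓ hℓ T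
    rw [expectedRegret]
    linarith
  · refine le_trans ?_ (potential_step hD le_rfl hK0 e c hx hη)
    have hq := (toActions_mem e (hΦ c)).1
    rw [actionDist, clip_zero _ hq, one_mul, add_sub_assoc]
    gcongr
    rw [Finset.filter_true_of_mem fun j _ => hq j, Finset.sum_sub_distrib, ← Finset.mul_sum]
    have : ∑ j, x j ≤ K := by
      simpa using Finset.sum_le_sum fun j (_ : j ∈ Finset.univ) => (hx j).2
    gcongr

/-- Clipping turns the additive cost per round into a relative one, so no `T` appears: surviving
weights are at least `ρ`, and renormalization inflates them by at most `1 / (1 - K ρ)`. -/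
theorem mul_expectedLoss_le (hD : IsSmoothLaw D η) (hη : 0 ≤ η) (hρ : 0 < ρ) (hρK : K * ρ < 1)
    (hηρ : η ≤ 2 * ρ)
    (E : ℕ → Fin (n + 1) → Fin K) (ℓ : ℕ → Fin K → ℝ)
    (hℓ : ∀ t j, ℓ t j ∈ Set.Icc (0 : ℝ) 1) (T : ℕ) :
    (1 - η / (2 * ρ)) * (1 - K * ρ) * expectedLoss (ftplPotential (n + 1) D) ρ E ℓ T
      ≤ bestLoss E ℓ T + (-(∫ x, x ∂D) - ftplPotential (n + 1) D 0) := by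
  have hΦ := grad_ftplPotential_mem (n := n) hD
  have h := le_sum_trajProb_potential E ℓ hΦ hρ.le hρK
    (κ := (1 - η / (2 * ρ)) * (1 - K * ρ)) (β := 0) hℓ (fun e c x hx => ?_) T
  · have h2 := sum_trajProb_potential_le hD hρ.le hρK E ℓ hℓ T
    linarith
  · refine le_trans ?_ (potential_step hD hρ.le hρK e c hx hη)
    rw [sub_zero, actionDist]
    set q := toActions e (grad (ftplPotential (n + 1) D) c) with hqdef
    have hq : q ∈ stdSimplex ℝ (Fin K) := toActions_mem e (hΦ c)
    gcongr
    rw [Finset.sum_filter, Finset.mul_sum]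
    refine Finset.sum_le_sum fun j _ => ?_
    have hδ := sum_clipped_le hρ.le q
    have h1 : 0 ≤ 1 - η / (2 * ρ) := by
      rw [sub_nonneg, div_le_one (by linarith)]; exact hηρ
    rw [clip]
    split_ifs with hj
    · have h2 : (1 - K * ρ) * (q j / (1 - ∑ j with q j < ρ, q j)) ≤ q j := by
        rw [mul_div_assoc', div_le_iff₀ (by linarith), mul_comm]
        exact mul_le_mul_of_nonneg_left (by linarith) (hq.1 j)
      calc (1 - η / (2 * ρ)) * (1 - K * ρ) * (q j / (1 - ∑ j with q j < ρ, q j) * x j)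
          = (1 - η / (2 * ρ)) * ((1 - K * ρ) * (q j / (1 - ∑ j with q j < ρ, q j))) * x j := by
            ring
        _ ≤ (1 - η / (2 * ρ)) * q j * x j := by
            gcongr
            exact (hx j).1
        _ = q j * x j - η / 2 * x j * (q j / ρ) := by field_simp
        -- This is where the threshold enters: `q j / ρ ≥ 1` for a survivor.
        _ ≤ q j * x j - η / 2 * x j * 1 := by
            have := (hx j).1
            gcongr
            exact (one_le_div hρ).2 hj
        _ = _ := by ring
    · simp

/-- With a single expert the algorithm follows the advice. -/
theorem expectedRegret_single {Φ : (Fin 1 → ℝ) → ℝ}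
    (hΦ : ∀ c, grad Φ c ∈ stdSimplex ℝ (Fin 1)) (hρ : 0 ≤ ρ) (hρK : K * ρ < 1) (hK : 0 < K)
    (E : ℕ → Fin 1 → Fin K) (ℓ : ℕ → Fin K → ℝ) (T : ℕ) :
    expectedRegret Φ ρ E ℓ T = 0 := by
  have hρ1 : ρ < 1 := by
    have : (1 : ℝ) ≤ K := by exact_mod_cast hK
    nlinarith
  have hact : ∀ (e : Fin 1 → Fin K) c, actionDist Φ ρ e c = Pi.single (e 0) 1 := fun e c => by
    have hg : grad Φ c 0 = 1 := by simpa using (hΦ c).2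
    have hs : ∀ j, toActions e (grad Φ c) j = if e 0 = j then 1 else 0 := fun j => by
      simp [toActions, Finset.sum_filter, hg]
    have hδ : ∑ j with toActions e (grad Φ c) j < ρ, toActions e (grad Φ c) j = 0 := by
      refine Finset.sum_eq_zero fun j hj => ?_
      have := (Finset.mem_filter.1 hj).2
      rw [hs] at this ⊢
      split_ifs at this ⊢ with h
      · linarith
      · rfl
    ext j
    rw [actionDist, clip, hδ, hs, Pi.single_apply]
    rcases eq_or_ne (e 0) j with h | h
    · simp [h, hρ1.le]
    · simp [h, h.symm]
  rw [expectedRegret, bestLoss, ciInf_unique, sub_eq_zero]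
  induction T with
  | zero => simp [expectedLoss]
  | succ t ih =>
    rw [expectedLoss_succ E ℓ hΦ hρ hρK, Finset.sum_range_succ, ih]
    simp [hact, Pi.single_apply, ← Finset.sum_mul, sum_trajProb E ℓ hΦ hρ hρK]

end Regret

/-! ### Perturbation laws given by a density -/

section Density

variable {f : ℝ → ℝ}

theorem integrable_withDensity_ofReal_iff (hf : Measurable f) (hf0 : ∀ x, 0 ≤ f x) {g : ℝ → ℝ} :
    Integrable g (volume.withDensity fun x => ENNReal.ofReal (f x))
      ↔ Integrable fun x => f x * g x := by
  rw [integrable_withDensity_iff_integrable_smul' hf.ennreal_ofReal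
    (ae_of_all _ fun x => ENNReal.ofReal_lt_top)]
  simp only [ENNReal.toReal_ofReal (hf0 _), smul_eq_mul]

theorem integral_withDensity_ofReal (hf : Measurable f) (hf0 : ∀ x, 0 ≤ f x) (g : ℝ → ℝ) :
    ∫ x, g x ∂(volume.withDensity fun x => ENNReal.ofReal (f x)) = ∫ x, f x * g x := by
  rw [integral_withDensity_eq_integral_toReal_smul hf.ennreal_ofReal
    (ae_of_all _ fun x => ENNReal.ofReal_lt_top)]
  simp only [ENNReal.toReal_ofReal (hf0 _), smul_eq_mul]

theorem isProbabilityMeasure_withDensity_ofReal (hf0 : ∀ x, 0 ≤ f x)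
    (hint : Integrable f) (h1 : ∫ x, f x = 1) :
    IsProbabilityMeasure (volume.withDensity fun x => ENNReal.ofReal (f x)) where
  measure_univ := by
    rw [withDensity_apply _ MeasurableSet.univ, Measure.restrict_univ,
      ← ofReal_integral_eq_lintegral_ofReal hint (ae_of_all _ hf0), h1, ENNReal.ofReal_one]

/-- Translation invariance of Lebesgue measure reduces the shift property to a pointwise comparison
of densities. -/
theorem shift_withDensity_ofReal {η s : ℝ}
    (hs : ∀ x, Real.exp (-(η * s)) * f x ≤ f (x + s)) {A : Set ℝ} (hA : MeasurableSet A) :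
    ENNReal.ofReal (Real.exp (-(η * s))) * volume.withDensity (fun x => ENNReal.ofReal (f x)) A
      ≤ volume.withDensity (fun x => ENNReal.ofReal (f x)) ((fun x => x - s) ⁻¹' A) := by
  have hA' : MeasurableSet ((fun x : ℝ => x - s) ⁻¹' A) := (measurable_id.sub_const s) hA
  rw [withDensity_apply _ hA, withDensity_apply _ hA', ← lintegral_indicator hA,
    ← lintegral_indicator hA', ← lintegral_const_mul' _ _ ENNReal.ofReal_ne_top]
  have h : ∀ x, ((fun x : ℝ => x - s) ⁻¹' A).indicator (fun x => ENNReal.ofReal (f x)) x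
      = (fun y => A.indicator (fun y => ENNReal.ofReal (f (y + s))) y) (x - s) := fun x => by
    simp [Set.indicator]
    rfl
  simp_rw [h]
  rw [lintegral_sub_right_eq_self]
  refine lintegral_mono fun x => ?_
  by_cases hx : x ∈ A
  · simp only [Set.indicator_of_mem hx]
    rw [← ENNReal.ofReal_mul (Real.exp_nonneg _)]
    exact ENNReal.ofReal_le_ofReal (hs x)
  · simp [Set.indicator_of_notMem hx]

theorem isSmoothLaw_withDensity (hf : Measurable f) (hf0 : ∀ x, 0 ≤ f x)
    (hprob : IsProbabilityMeasure (volume.withDensity fun x => ENNReal.ofReal (f x)))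
    (hint : Integrable fun x => f x * x) {η : ℝ}
    (hs : ∀ s, 0 ≤ s → ∀ x, Real.exp (-(η * s)) * f x ≤ f (x + s)) :
    IsSmoothLaw (volume.withDensity fun x => ENNReal.ofReal (f x)) η where
  isProbabilityMeasure := hprob
  singleton x := withDensity_absolutelyContinuous _ _ (by simp)
  integrable := (integrable_withDensity_ofReal_iff hf hf0).2 hint
  shift s h A hA := shift_withDensity_ofReal (hs s h) hA

end Density

/-- The left side is `𝔼[max Z]`. Each `Z i` is at most `A + ε * ∑ k, G (Z k)`, hence so is the
maximum; `G` is a moment function and `ε` will be of order `1 / N`, up to scale. -/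
theorem neg_ftplPotential_zero_le {n : ℕ} {D : Measure ℝ} {η : ℝ} (hD : IsSmoothLaw D η)
    {G : ℝ → ℝ} (hG0 : ∀ x, 0 ≤ G x) (hG : Integrable G D) {A ε : ℝ} (hε : 0 ≤ ε)
    (h : ∀ x, x ≤ A + ε * G x) :
    -ftplPotential (n + 1) D 0 ≤ A + ε * ((n + 1 : ℕ) * ∫ x, G x ∂D) := by
  have := hD.isProbabilityMeasure
  have hGi : ∀ i : Fin (n + 1), Integrable (fun z : Fin (n + 1) → ℝ => G (z i))
      (Measure.pi fun _ => D) := fun i =>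
    (measurePreserving_eval (fun _ : Fin (n + 1) => D) i).integrable_comp_of_integrable hG
  have hsum := integrable_finsetSum Finset.univ fun i (_ : i ∈ Finset.univ) => hGi i
  have e : A + ε * ((n + 1 : ℕ) * ∫ x, G x ∂D)
      = ∫ z : Fin (n + 1) → ℝ, (A + ε * ∑ i, G (z i)) ∂(Measure.pi fun _ => D) := by
    rw [integral_add (integrable_const _) (hsum.const_mul ε), integral_const_mul,
      integral_finsetSum _ fun i _ => hGi i]
    simp [integral_eval _ hG.aestronglyMeasurable]
  rw [e, ftplPotential, ← integral_neg]
  refine integral_mono (integrable_iInf_sub hD 0).neg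
    ((integrable_const _).add (hsum.const_mul ε)) fun z => ?_
  have : -(A + ε * ∑ i, G (z i)) ≤ ⨅ i, ((0 : Fin (n + 1) → ℝ) i - z i) := le_ciInf fun i => by
    have h1 : G (z i) ≤ ∑ i, G (z i) :=
      Finset.single_le_sum (f := fun i => G (z i)) (fun _ _ => hG0 _) (Finset.mem_univ i)
    have h2 := mul_le_mul_of_nonneg_left h1 hε
    have h3 := h (z i)
    simp only [Pi.zero_apply]
    linarith
  simp only
  linarith

/-! ### Laws with exponential tails -/

theorem integrable_exp_neg_mul_abs {c : ℝ} (hc : 0 < c) :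
    Integrable fun x : ℝ => Real.exp (-c * |x|) := by
  rw [← integrableOn_univ, ← Set.Iic_union_Ioi (a := (0 : ℝ))]
  refine IntegrableOn.union ?_ ?_
  · refine (integrableOn_exp_mul_Iic hc 0).congr_fun (fun x hx => ?_) measurableSet_Iic
    simp [abs_of_nonpos (Set.mem_Iic.1 hx)]
  · refine (integrableOn_exp_mul_Ioi (neg_lt_zero.2 hc) 0).congr_fun (fun x hx => ?_)
      measurableSet_Ioi
    simp [abs_of_pos (Set.mem_Ioi.1 hx)]

theorem integral_exp_neg_mul_abs {c : ℝ} (hc : 0 < c) :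
    ∫ x : ℝ, Real.exp (-c * |x|) = 2 / c := by
  rw [integral_comp_abs (f := fun x => Real.exp (-c * x)),
    integral_exp_mul_Ioi (neg_lt_zero.2 hc)]
  simp
  ring

theorem le_exp_half_mul {η : ℝ} (hη : 0 < η) (x : ℝ) :
    x ≤ 2 / η * Real.exp (η / 2 * x) := by
  have h := Real.add_one_le_exp (η / 2 * x)
  calc x = 2 / η * (η / 2 * x) := by field_simp
    _ ≤ _ := by gcongr; linarith

theorem exists_law_of_exp_tail {f : ℝ → ℝ} (hf : Measurable f) (hf0 : ∀ x, 0 ≤ f x)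
    (hprob : IsProbabilityMeasure (volume.withDensity fun x => ENNReal.ofReal (f x)))
    {η : ℝ} (hη : 0 < η) (htail : ∀ x, f x ≤ 2 * η * Real.exp (-η * |x|))
    (hs : ∀ s, 0 ≤ s → ∀ x, Real.exp (-(η * s)) * f x ≤ f (x + s)) :
    IsSmoothLaw (volume.withDensity fun x => ENNReal.ofReal (f x)) η ∧
      ∀ n : ℕ, -(∫ x, x ∂(volume.withDensity fun x => ENNReal.ofReal (f x)))
        - ftplPotential (n + 1) (volume.withDensity fun x => ENNReal.ofReal (f x)) 0
        ≤ (2 * Real.log (n + 1 : ℕ) + 32) / η := by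
  set D := volume.withDensity fun x => ENNReal.ofReal (f x) with hDdef
  -- Half the decay rate keeps `G` integrable: `∫ 2η exp (-(η/2)|x|) = 8`. The mean and the maximum
  -- each then contribute `16 / η`.
  set G : ℝ → ℝ := fun x => Real.exp (η / 2 * |x|) with hGdef
  have hGm : Measurable G := by fun_prop
  have hη2 : 0 < η / 2 := by positivity
  have hfG : ∀ x, f x * G x ≤ 2 * η * Real.exp (-(η / 2) * |x|) := fun x => by
    calc f x * G x ≤ 2 * η * Real.exp (-η * |x|) * G x := by
          gcongr
          exact htail x
      _ = _ := by rw [hGdef, mul_assoc, ← Real.exp_add]; ring_nf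
  have hmaj := (integrable_exp_neg_mul_abs hη2).const_mul (2 * η)
  have hGint : Integrable fun x => f x * G x := hmaj.mono' (hf.mul hGm).aestronglyMeasurable
    (ae_of_all _ fun x => by
      rw [Real.norm_of_nonneg (mul_nonneg (hf0 x) (Real.exp_nonneg _))]; exact hfG x)
  have hGD : Integrable G D := (integrable_withDensity_ofReal_iff hf hf0).2 hGint
  have hGM : ∫ x, G x ∂D ≤ 8 := by
    rw [integral_withDensity_ofReal hf hf0]
    refine (integral_mono hGint hmaj hfG).trans_eq ?_
    rw [integral_const_mul, integral_exp_neg_mul_abs hη2]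
    field_simp
    norm_num
  have hidD : Integrable (fun x => x) D := (hGD.const_mul (2 / η)).mono'
    measurable_id.aestronglyMeasurable (ae_of_all _ fun x => le_exp_half_mul hη |x|)
  have hD : IsSmoothLaw D η := isSmoothLaw_withDensity hf hf0 hprob
    ((integrable_withDensity_ofReal_iff hf hf0).1 hidD) hs
  refine ⟨hD, fun n => ?_⟩
  have hmean : -(∫ x, x ∂D) ≤ 16 / η := by
    rw [← integral_neg]
    have h := integral_mono hidD.neg (hGD.const_mul (2 / η)) fun x =>
      (neg_le_abs x).trans (le_exp_half_mul hη |x|)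
    rw [integral_const_mul] at h
    calc _ ≤ 2 / η * ∫ x, G x ∂D := h
      _ ≤ 2 / η * 8 := by gcongr
      _ = 16 / η := by ring
  have hN : (0 : ℝ) < (n + 1 : ℕ) := by positivity
  have hpot := neg_ftplPotential_zero_le (n := n) hD (fun x => (Real.exp_nonneg _ : 0 ≤ G x)) hGD
    (A := 2 / η * Real.log (n + 1 : ℕ)) (ε := 2 / η * ((n + 1 : ℕ) : ℝ)⁻¹) (by positivity)
    fun x => by
      have h := le_exp_half_mul hη (x - 2 / η * Real.log (n + 1 : ℕ))
      have e : η / 2 * (x - 2 / η * Real.log (n + 1 : ℕ)) = η / 2 * x - Real.log (n + 1 : ℕ) := by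
        field_simp
      rw [e, Real.exp_sub, Real.exp_log hN] at h
      have h2 : Real.exp (η / 2 * x) ≤ G x := by
        exact Real.exp_le_exp.2 (mul_le_mul_of_nonneg_left (le_abs_self x) hη2.le)
      calc x ≤ 2 / η * Real.log (n + 1 : ℕ) + 2 / η * (Real.exp (η / 2 * x) / (n + 1 : ℕ)) := by
            linarith
        _ ≤ 2 / η * Real.log (n + 1 : ℕ) + 2 / η * (G x / (n + 1 : ℕ)) := by gcongr
        _ = _ := by ring
  have h3 : 2 / η * ((n + 1 : ℕ) : ℝ)⁻¹ * ((n + 1 : ℕ) * ∫ x, G x ∂D) ≤ 16 / η := by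
    calc _ = 2 / η * ∫ x, G x ∂D := by field_simp
      _ ≤ 2 / η * 8 := by gcongr
      _ = 16 / η := by ring
  calc _ ≤ 16 / η + (2 / η * Real.log (n + 1 : ℕ) + 16 / η) := by linarith
    _ = _ := by ring

/-! ### Laws with polynomial tails -/

/-- Above the truncation level `Y`, `y = y ^ (1 - r) * y ^ r` and the first factor is at most `Y ^
(1 - r)`. -/
theorem le_add_mul_max_rpow {r Y : ℝ} (hr : 1 ≤ r) (hY : 1 ≤ Y) (y : ℝ) :
    y ≤ Y + Y ^ (1 - r) * max y 1 ^ r := by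
  have h0 : 0 ≤ Y ^ (1 - r) * max y 1 ^ r := by positivity
  rcases le_total y Y with h | h
  · linarith
  · have hy : 0 < y := by linarith
    rw [max_eq_left (hY.trans h)]
    have h1 : y ^ (1 - r) ≤ Y ^ (1 - r) :=
      Real.rpow_le_rpow_of_nonpos (by linarith) h (by linarith)
    calc y = y ^ (1 - r) * y ^ r := by
          rw [← Real.rpow_add hy, sub_add_cancel, Real.rpow_one]
      _ ≤ Y ^ (1 - r) * y ^ r := by gcongr
      _ ≤ _ := by linarith

theorem exists_law_of_power_tail {f : ℝ → ℝ} (hf : Measurable f) (hf0 : ∀ x, 0 ≤ f x)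
    (hprob : IsProbabilityMeasure (volume.withDensity fun x => ENNReal.ofReal (f x)))
    {α σ : ℝ} (hα : 2 ≤ α) (hσ : 0 < σ) (hneg : ∀ x, x ≤ 0 → f x = 0)
    (htail : ∀ x, σ < x → f x ≤ α / σ * (x / σ) ^ (-1 - α)) {η : ℝ}
    (hs : ∀ s, 0 ≤ s → ∀ x, Real.exp (-(η * s)) * f x ≤ f (x + s)) :
    IsSmoothLaw (volume.withDensity fun x => ENNReal.ofReal (f x)) η ∧
      ∀ n : ℕ, -(∫ x, x ∂(volume.withDensity fun x => ENNReal.ofReal (f x)))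
        - ftplPotential (n + 1) (volume.withDensity fun x => ENNReal.ofReal (f x)) 0
        ≤ 4 * σ * ((n + 1 : ℕ) : ℝ) ^ (2 / α) := by
  set D := volume.withDensity fun x => ENNReal.ofReal (f x) with hDdef
  -- Half the tail exponent: this moment is finite, and `α ≥ 2` makes it dominate the first one. Its
  -- bound `3` is total mass `1` plus tail integral `α / r = 2`.
  set r : ℝ := α / 2 with hr
  have hr1 : 1 ≤ r := by rw [hr]; linarith
  set G : ℝ → ℝ := fun x => max (x / σ) 1 ^ r with hGdef
  have hG0 : ∀ x, 0 ≤ G x := fun x => by positivity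
  have hGm : Measurable G := by fun_prop
  have hfint : Integrable f := by
    have h : Integrable (fun _ => (1 : ℝ)) D := integrable_const _
    simpa using (integrable_withDensity_ofReal_iff hf hf0).1 h
  have hf1 : ∫ x, f x = 1 := by
    have h := integral_withDensity_ofReal hf hf0 fun _ => 1
    simpa [← hDdef] using h.symm
  set h : ℝ → ℝ := (Set.Ioi σ).indicator fun x => α * σ ^ r * x ^ (-1 - r) with hhdef
  have hion : IntegrableOn (fun x : ℝ => α * σ ^ r * x ^ (-1 - r)) (Set.Ioi σ) :=
    (integrableOn_Ioi_rpow_of_lt (by linarith) hσ).const_mul _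
  have hhint : Integrable h := hion.integrable_indicator measurableSet_Ioi
  have hh : ∫ x, h x = 2 := by
    rw [integral_indicator measurableSet_Ioi, integral_const_mul,
      integral_Ioi_rpow_of_lt (by linarith) hσ]
    have e : -1 - r + 1 = -r := by ring
    rw [e, Real.rpow_neg hσ.le, hr]
    have : σ ^ (α / 2) ≠ 0 := by positivity
    field_simp
  have hfG : ∀ x, f x * G x ≤ f x + h x := fun x => by
    rcases le_or_gt x σ with hx | hx
    · have : G x = 1 := by
        rw [hGdef]
        simp only
        rw [max_eq_right ((div_le_one hσ).2 hx), Real.one_rpow]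
      rw [this, hhdef, Set.indicator_of_notMem (by simpa using hx)]
      linarith
    · have hx0 : 0 < x := hσ.trans hx
      have e : h x = α / σ * (x / σ) ^ (-1 - α) * G x := by
        rw [hhdef, Set.indicator_of_mem (Set.mem_Ioi.2 hx), hGdef]
        simp only
        rw [max_eq_left ((one_le_div hσ).2 hx.le), mul_assoc (α / σ), ← Real.rpow_add (by positivity)]
        have e1 : -1 - α + r = -1 - r := by rw [hr]; ring
        rw [e1, Real.div_rpow hx0.le hσ.le, Real.rpow_sub hσ, Real.rpow_neg_one]
        field_simp
      rw [e]
      have := mul_le_mul_of_nonneg_right (htail x hx) (hG0 x)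
      linarith [hf0 x]
  have hGint : Integrable fun x => f x * G x := (hfint.add hhint).mono'
    (hf.mul hGm).aestronglyMeasurable (ae_of_all _ fun x => by
      rw [Real.norm_of_nonneg (mul_nonneg (hf0 x) (hG0 x))]; exact hfG x)
  have hGD : Integrable G D := (integrable_withDensity_ofReal_iff hf hf0).2 hGint
  have hGM : ∫ x, G x ∂D ≤ 3 := by
    rw [integral_withDensity_ofReal hf hf0]
    refine (integral_mono hGint (hfint.add hhint) hfG).trans_eq ?_
    have := integral_add hfint hhint
    simp only [Pi.add_apply]
    rw [this, hf1, hh]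
    norm_num
  have hidD : Integrable fun x => f x * x := by
    refine (hGint.const_mul σ).mono' (hf.mul measurable_id).aestronglyMeasurable
      (ae_of_all _ fun x => ?_)
    rcases le_or_gt x 0 with hx | hx
    · simp [hneg x hx]
    · rw [Real.norm_of_nonneg (mul_nonneg (hf0 x) hx.le)]
      have h1 : max (x / σ) 1 ≤ G x := by
        have := Real.rpow_le_rpow_of_exponent_le (le_max_right (x / σ) 1) hr1
        rwa [Real.rpow_one] at this
      have h2 : x ≤ σ * G x := by
        rw [← div_le_iff₀' hσ]
        exact (le_max_left _ _).trans h1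
      calc f x * x ≤ f x * (σ * G x) := mul_le_mul_of_nonneg_left h2 (hf0 x)
        _ = _ := by ring
  have hD : IsSmoothLaw D η := isSmoothLaw_withDensity hf hf0 hprob hidD hs
  refine ⟨hD, fun n => ?_⟩
  have hmean : 0 ≤ ∫ x, x ∂D := by
    rw [integral_withDensity_ofReal hf hf0]
    refine integral_nonneg fun x => ?_
    rcases le_or_gt x 0 with hx | hx
    · simp [hneg x hx]
    · exact mul_nonneg (hf0 x) hx.le
  set M : ℝ := ((n + 1 : ℕ) : ℝ) with hM
  have hM1 : 1 ≤ M := by rw [hM]; exact_mod_cast Nat.succ_le_succ (Nat.zero_le n)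
  have hM0 : 0 < M := by linarith
  -- `Y = M ^ (1 / r)` balances truncation level and tail, since then `Y ^ (1 - r) * M = Y`.
  set Y : ℝ := M ^ (2 / α) with hY
  have hY1 : 1 ≤ Y := Real.one_le_rpow hM1 (by positivity)
  have hpot := neg_ftplPotential_zero_le (n := n) hD hG0 hGD (A := σ * Y)
    (ε := σ * Y ^ (1 - r)) (by positivity) fun x => by
      have := le_add_mul_max_rpow hr1 hY1 (x / σ)
      rw [div_le_iff₀ hσ] at this
      linarith
  rw [← hM] at hpot
  have hYM : Y ^ (1 - r) * M = Y := by
    rw [hY, ← Real.rpow_mul hM0.le]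
    nth_rewrite 2 [← Real.rpow_one M]
    rw [← Real.rpow_add hM0]
    congr 1
    rw [hr]
    field_simp
    ring
  have : σ * Y ^ (1 - r) * (M * ∫ x, G x ∂D) ≤ σ * Y * 3 := by
    calc _ = σ * (Y ^ (1 - r) * M) * ∫ x, G x ∂D := by ring
      _ ≤ _ := by rw [hYM]; gcongr
  linarith

/-! ### The five families -/

theorem exists_law_exponential {η : ℝ} (hη : 0 < η) :
    IsSmoothLaw (gammaMeasure 1 η) η ∧
      ∀ n : ℕ, -(∫ x, x ∂(gammaMeasure 1 η)) - ftplPotential (n + 1) (gammaMeasure 1 η) 0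
        ≤ (2 * Real.log (n + 1 : ℕ) + 32) / η := by
  have hf : ∀ x, gammaPDFReal 1 η x = if 0 ≤ x then η * Real.exp (-(η * x)) else 0 := fun x => by
    simp [gammaPDFReal]
  refine exists_law_of_exp_tail (measurable_gammaPDFReal 1 η)
    (fun x => gammaPDFReal_nonneg one_pos hη x)
    (isProbabilityMeasure_gammaMeasure one_pos hη) hη (fun x => ?_) fun s hs x => ?_
  · rw [hf]
    have := Real.exp_nonneg (-η * |x|)
    split_ifs with hx
    · rw [abs_of_nonneg hx, neg_mul] at *
      nlinarith
    · positivity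
  · rw [hf, hf]
    split_ifs with hx hxs hxs
    · rw [mul_left_comm, ← Real.exp_add]
      apply le_of_eq
      ring_nf
    · exact absurd (add_nonneg hx hs) hxs
    · rw [mul_zero]; positivity
    · simp

/-- Both are the exponential law of rate `η`; the density formulas differ at most at `0`. -/
theorem weibullMeasure_one {η : ℝ} : weibullMeasure η⁻¹ 1 = gammaMeasure 1 η := by
  refine withDensity_congr_ae ?_
  have h0 : ∀ᵐ x : ℝ, x ≠ 0 := by simp [ae_iff]
  filter_upwards [h0] with x hx
  rw [gammaPDF, gammaPDFReal]
  rcases lt_or_gt_of_ne hx with h | h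
  · simp [h.not_gt, h.not_ge]
  · simp [h, h.le, mul_comm]

theorem exists_law_gumbel {η : ℝ} (hη : 0 < η) :
    IsSmoothLaw (gumbelMeasure 0 η⁻¹) η ∧
      ∀ n : ℕ, -(∫ x, x ∂(gumbelMeasure 0 η⁻¹)) - ftplPotential (n + 1) (gumbelMeasure 0 η⁻¹) 0
        ≤ (2 * Real.log (n + 1 : ℕ) + 32) / η := by
  set f : ℝ → ℝ := fun x => η * Real.exp (-(x * η + Real.exp (-(x * η)))) with hfdef
  have hm : gumbelMeasure 0 η⁻¹ = volume.withDensity fun x => ENNReal.ofReal (f x) := by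
    simp [gumbelMeasure, hfdef]
  rw [hm]
  have hfm : Measurable f := by fun_prop
  have hf0 : ∀ x, 0 ≤ f x := fun x => by positivity
  have htail : ∀ x, f x ≤ 2 * η * Real.exp (-η * |x|) := fun x => by
    rw [mul_comm 2 η, mul_assoc]
    refine mul_le_mul_of_nonneg_left ?_ hη.le
    rcases le_or_gt 0 x with hx | hx
    · rw [abs_of_nonneg hx]
      have h1 : Real.exp (-(x * η + Real.exp (-(x * η)))) ≤ Real.exp (-η * x) :=
        Real.exp_le_exp.2 (by linarith [Real.exp_nonneg (-(x * η))])
      linarith [Real.exp_nonneg (-η * x)]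
    · rw [abs_of_neg hx]
      set u := Real.exp (-(x * η)) with hu
      have hu0 : 0 < u := Real.exp_pos _
      have e1 : Real.exp (-η * -x) = u⁻¹ := by rw [hu, ← Real.exp_neg]; ring_nf
      have e2 : Real.exp (-(x * η + u)) = u * (Real.exp u)⁻¹ := by
        rw [neg_add, Real.exp_add, ← Real.exp_neg u]
      rw [e1, e2, ← div_eq_mul_inv, ← div_eq_mul_inv, div_le_div_iff₀ (Real.exp_pos _) hu0]
      -- The left tail reduces to `u² ≤ 2 exp u`, the source of the factor `2` in the tail bound.
      nlinarith [Real.quadratic_le_exp_of_nonneg hu0.le]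
  have hint : Integrable f := ((integrable_exp_neg_mul_abs hη).const_mul (2 * η)).mono'
    hfm.aestronglyMeasurable (ae_of_all _ fun x => by
      rw [Real.norm_of_nonneg (hf0 x)]; exact htail x)
  have hexp : Filter.Tendsto (fun x : ℝ => -(x * η)) Filter.atTop Filter.atBot :=
    Filter.tendsto_neg_atTop_atBot.comp (Filter.tendsto_id.atTop_mul_const hη)
  have hexp' : Filter.Tendsto (fun x : ℝ => -(x * η)) Filter.atBot Filter.atTop :=
    Filter.tendsto_neg_atBot_atTop.comp (Filter.tendsto_id.atBot_mul_const hη)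
  have h1 : ∫ x, f x = 1 := by
    have hd : ∀ x, HasDerivAt (fun x => Real.exp (-Real.exp (-(x * η)))) (f x) x := fun x => by
      have := ((((hasDerivAt_id x).mul_const η).neg.exp).neg).exp
      refine this.congr_deriv ?_
      simp only [id, hfdef, Pi.neg_apply]
      rw [neg_add, Real.exp_add]
      ring
    have hbot : Filter.Tendsto (fun x => Real.exp (-Real.exp (-(x * η)))) Filter.atBot
        (nhds 0) :=
      Real.tendsto_exp_atBot.comp
        (Filter.tendsto_neg_atTop_atBot.comp (Real.tendsto_exp_atTop.comp hexp'))
    have htop : Filter.Tendsto (fun x => Real.exp (-Real.exp (-(x * η)))) Filter.atTop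
        (nhds 1) := by
      have := (Real.continuous_exp.tendsto _).comp (Real.tendsto_exp_atBot.comp hexp).neg
      simpa [Function.comp_def] using this
    rw [integral_of_hasDerivAt_of_tendsto hd hint hbot htop, sub_zero]
  refine exists_law_of_exp_tail hfm hf0
    (isProbabilityMeasure_withDensity_ofReal hf0 hint h1) hη htail fun s hs x => ?_
  rw [hfdef]
  simp only
  rw [mul_left_comm, ← Real.exp_add]
  refine mul_le_mul_of_nonneg_left (Real.exp_le_exp.2 ?_) hη.le
  have : Real.exp (-((x + s) * η)) ≤ Real.exp (-(x * η)) :=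
    Real.exp_le_exp.2 (by nlinarith)
  linarith

theorem exists_law_pareto {α σ : ℝ} (hα : 2 ≤ α) (hσ : 0 < σ) :
    IsSmoothLaw (paretoMeasure σ α) (4 * α / σ) ∧
      ∀ n : ℕ, -(∫ x, x ∂(paretoMeasure σ α)) - ftplPotential (n + 1) (paretoMeasure σ α) 0
        ≤ 4 * σ * ((n + 1 : ℕ) : ℝ) ^ (2 / α) := by
  have hα0 : 0 < α := by linarith
  have hf0 : ∀ x, 0 ≤ paretoPDFReal σ α x := fun x => paretoPDFReal_nonneg hσ.le hα0.le x
  refine exists_law_of_power_tail (measurable_paretoPDFReal σ α) hf0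
    (isProbabilityMeasure_paretoMeasure hσ hα0) hα hσ (fun x hx => ?_) (fun x hx => ?_)
    fun s hs x => ?_
  · rw [paretoPDFReal, if_neg (by linarith)]
  · rw [paretoPDFReal, if_pos hx.le]
    have hx0 : 0 < x := hσ.trans hx
    have e : -1 - α = -(α + 1) := by ring
    rw [e, Real.div_rpow hx0.le hσ.le, Real.rpow_neg hσ.le, Real.rpow_add hσ, Real.rpow_one]
    apply le_of_eq
    field_simp
  · rcases lt_or_ge x σ with hx | hx
    · rw [paretoPDFReal, if_neg hx.not_ge, mul_zero]
      exact hf0 _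
    · have hx0 : 0 < x := hσ.trans_le hx
      rw [paretoPDFReal, paretoPDFReal, if_pos hx, if_pos (by linarith), mul_left_comm]
      refine mul_le_mul_of_nonneg_left ?_ (by positivity)
      -- Valid because `x ≥ σ`. It yields the rate `(α + 1) / σ`; the larger `4 * α / σ` is shared
      -- with the Fréchet law.
      have h1 : x + s ≤ x * Real.exp (s / σ) := by
        have h2 := Real.add_one_le_exp (s / σ)
        have h3 : s ≤ x * (s / σ) := by
          rw [mul_div_assoc', le_div_iff₀ hσ, mul_comm]
          exact mul_le_mul_of_nonneg_right hx hs
        nlinarith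
      have h4 := Real.rpow_le_rpow_of_nonpos (z := -(α + 1)) (by positivity : 0 < x + s) h1
        (by linarith)
      refine le_trans ?_ h4
      rw [Real.mul_rpow hx0.le (Real.exp_nonneg _), mul_comm, ← Real.exp_mul]
      refine mul_le_mul_of_nonneg_left (Real.exp_le_exp.2 ?_) (by positivity)
      have h5 : 0 ≤ s / σ := by positivity
      have e : 4 * α / σ * s = 4 * α * (s / σ) := by ring
      rw [e]
      nlinarith

/-- Up to a constant this is the log-density at unit scale plus `4 α y`; its monotonicity is the
shift property. In the derivative times `y`, the term `4 α y` beats `1 + α` when `y ≥ 1/2`, and `α y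
^ (-α) ≥ 2 α` does when `y ≤ 1/2`. -/
theorem monotoneOn_log_frechet {α : ℝ} (hα : 2 ≤ α) :
    MonotoneOn (fun y : ℝ => 4 * α * y + Real.log y * (-1 - α) - y ^ (-α)) (Set.Ioi 0) := by
  have hd : ∀ y : ℝ, 0 < y → HasDerivAt
      (fun y : ℝ => 4 * α * y + Real.log y * (-1 - α) - y ^ (-α))
      (4 * α + y⁻¹ * (-1 - α) - (-α) * y ^ (-α - 1)) y := fun y hy => by
    have := (((hasDerivAt_id y).const_mul (4 * α)).add
      ((Real.hasDerivAt_log hy.ne').mul_const (-1 - α))).sub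
      (Real.hasDerivAt_rpow_const (p := -α) (Or.inl hy.ne'))
    exact this.congr_deriv (by simp)
  refine monotoneOn_of_deriv_nonneg (convex_Ioi 0)
    (fun y hy => (hd y hy).continuousAt.continuousWithinAt) (fun y hy => ?_) fun y hy => ?_
  · rw [interior_Ioi] at hy
    exact (hd y hy).differentiableAt.differentiableWithinAt
  · rw [interior_Ioi] at hy
    have hy0 : 0 < y := hy
    rw [(hd y hy).deriv, Real.rpow_sub_one hy0.ne']
    have e : 4 * α + y⁻¹ * (-1 - α) - (-α) * (y ^ (-α) / y)
        = (4 * α * y - (1 + α) + α * y ^ (-α)) / y := by field_simp; ring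
    rw [e]
    refine div_nonneg ?_ hy0.le
    have hp : 0 ≤ y ^ (-α) := by positivity
    rcases le_total (1 / 2) y with h | h
    · nlinarith
    · have h2 : (2 : ℝ) ≤ y ^ (-α) := by
        have h3 : (1 / 2 : ℝ) ^ (-α) ≤ y ^ (-α) :=
          Real.rpow_le_rpow_of_nonpos hy0 h (by linarith)
        have h4 : (2 : ℝ) ^ (1 : ℝ) ≤ 2 ^ α :=
          Real.rpow_le_rpow_of_exponent_le (by norm_num) (by linarith)
        rw [one_div, Real.inv_rpow (by norm_num), Real.rpow_neg (by norm_num), inv_inv] at h3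
        rw [Real.rpow_one] at h4
        exact h4.trans h3
      nlinarith

theorem integral_frechet {α σ : ℝ} (hα : 0 < α) (hσ : 0 < σ) :
    let f : ℝ → ℝ := fun x =>
      if 0 < x then α / σ * (x / σ) ^ (-1 - α) * Real.exp (-(x / σ) ^ (-α)) else 0
    Integrable f ∧ ∫ x, f x = 1 := by
  intro f
  -- The distribution function, extended by `0`; it is continuous at `0` from the right because `x ^
  -- (-α)` blows up there.
  let F : ℝ → ℝ := fun x => if 0 < x then Real.exp (-(x / σ) ^ (-α)) else 0
  have hd : ∀ x ∈ Set.Ioi (0 : ℝ), HasDerivAt F (f x) x := fun x hx => by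
    have hx0 : 0 < x := hx
    have h1 : HasDerivAt (fun x => Real.exp (-(x / σ) ^ (-α))) (f x) x := by
      have := ((((hasDerivAt_id x).div_const σ).rpow_const (p := -α)
        (Or.inl (by simp only [id]; positivity))).neg).exp
      refine this.congr_deriv ?_
      simp only [id, f, if_pos hx0, Pi.neg_apply]
      have e : -1 - α = -α - 1 := by ring
      rw [e]
      ring
    refine h1.congr_of_eventuallyEq ?_
    filter_upwards [Ioi_mem_nhds hx0] with y hy
    exact if_pos hy
  have hpos : ∀ x ∈ Set.Ioi (0 : ℝ), 0 ≤ f x := fun x hx => by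
    have hx0 : 0 < x := hx
    simp only [f, if_pos hx0]
    positivity
  have hcont : ContinuousWithinAt F (Set.Ici 0) 0 := by
    rw [← continuousWithinAt_Ioi_iff_Ici, ContinuousWithinAt]
    have hF0 : F 0 = 0 := if_neg (lt_irrefl 0)
    rw [hF0]
    have h1 : Filter.Tendsto (fun x : ℝ => x / σ) (nhdsWithin 0 (Set.Ioi 0))
        (nhdsWithin 0 (Set.Ioi 0)) := by
      refine tendsto_nhdsWithin_iff.2 ⟨?_, ?_⟩
      · have : Filter.Tendsto (fun x : ℝ => x / σ) (nhds 0) (nhds (0 / σ)) :=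
          Filter.tendsto_id.div_const σ
        rw [zero_div] at this
        exact this.mono_left nhdsWithin_le_nhds
      · filter_upwards [self_mem_nhdsWithin] with x hx
        exact div_pos hx hσ
    have h2 := Real.tendsto_exp_atBot.comp (Filter.tendsto_neg_atTop_atBot.comp
      ((tendsto_rpow_neg_nhdsGT_zero (neg_lt_zero.2 hα)).comp h1))
    refine h2.congr' ?_
    filter_upwards [self_mem_nhdsWithin] with x hx
    exact (if_pos hx).symm
  have htop : Filter.Tendsto F Filter.atTop (nhds 1) := by
    have h1 : Filter.Tendsto (fun x : ℝ => x / σ) Filter.atTop Filter.atTop :=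
      Filter.tendsto_id.atTop_div_const hσ
    have h2 := (Real.continuous_exp.tendsto _).comp ((tendsto_rpow_neg_atTop hα).comp h1).neg
    rw [neg_zero, Real.exp_zero] at h2
    refine h2.congr' ?_
    filter_upwards [Filter.eventually_gt_atTop 0] with x hx
    exact (if_pos hx).symm
  have hind : f = (Set.Ioi 0).indicator f := by
    ext x
    by_cases hx : 0 < x
    · rw [Set.indicator_of_mem (Set.mem_Ioi.2 hx)]
    · rw [Set.indicator_of_notMem (by simpa using hx)]
      exact if_neg hx
  constructor
  · rw [hind]
    exact (integrableOn_Ioi_deriv_of_nonneg hcont hd hpos htop).integrable_indicator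
      measurableSet_Ioi
  · rw [hind, integral_indicator measurableSet_Ioi,
      integral_Ioi_of_hasDerivAt_of_nonneg hcont hd hpos htop]
    simp [F]

theorem exists_law_frechet {α σ : ℝ} (hα : 2 ≤ α) (hσ : 0 < σ) :
    IsSmoothLaw (frechetMeasure α σ) (4 * α / σ) ∧
      ∀ n : ℕ, -(∫ x, x ∂(frechetMeasure α σ)) - ftplPotential (n + 1) (frechetMeasure α σ) 0
        ≤ 4 * σ * ((n + 1 : ℕ) : ℝ) ^ (2 / α) := by
  have hα0 : 0 < α := by linarith
  obtain ⟨hint, h1⟩ := integral_frechet hα0 hσ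
  set f : ℝ → ℝ := fun x =>
    if 0 < x then α / σ * (x / σ) ^ (-1 - α) * Real.exp (-(x / σ) ^ (-α)) else 0 with hfdef
  have hf0 : ∀ x, 0 ≤ f x := fun x => by
    simp only [hfdef]
    split_ifs <;> positivity
  have hfm : Measurable f :=
    Measurable.ite measurableSet_Ioi (by fun_prop) measurable_const
  have hfexp : ∀ x, 0 < x →
      f x = α / σ * Real.exp (Real.log (x / σ) * (-1 - α) - (x / σ) ^ (-α)) := fun x hx => by
    simp only [hfdef, if_pos hx]
    rw [sub_eq_add_neg (_ * _), Real.exp_add, ← Real.rpow_def_of_pos (by positivity), mul_assoc]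
  refine exists_law_of_power_tail hfm hf0
    (isProbabilityMeasure_withDensity_ofReal hf0 hint h1) hα hσ
    (fun x hx => if_neg hx.not_gt) (fun x hx => ?_) fun s hs x => ?_
  · have hx0 : 0 < x := hσ.trans hx
    simp only [hfdef, if_pos hx0]
    refine mul_le_of_le_one_right (by positivity) (Real.exp_le_one_iff.2 ?_)
    exact neg_nonpos.2 (by positivity)
  · rcases le_or_gt x 0 with hx | hx
    · have : f x = 0 := if_neg hx.not_gt
      rw [this, mul_zero]
      exact hf0 _
    · rw [hfexp x hx, hfexp (x + s) (by linarith), mul_left_comm, ← Real.exp_add]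
      refine mul_le_mul_of_nonneg_left (Real.exp_le_exp.2 ?_) (by positivity)
      have hm := monotoneOn_log_frechet hα (Set.mem_Ioi.2 (by positivity : 0 < x / σ))
        (Set.mem_Ioi.2 (by positivity : 0 < (x + s) / σ)) (by gcongr; linarith)
      simp only at hm
      have e : 4 * α * ((x + s) / σ) = 4 * α * (x / σ) + 4 * α / σ * s := by ring
      rw [e] at hm
      linarith

theorem two_thirds_le_log_succ {n : ℕ} (hn : 1 ≤ n) : 2 / 3 ≤ Real.log (n + 1 : ℕ) := by
  have h : Real.log 2 ≤ Real.log (n + 1 : ℕ) :=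
    Real.log_le_log (by norm_num) (by exact_mod_cast Nat.succ_le_succ hn)
  linarith [Real.log_two_gt_d9]

/-- The parameters of a family can be tuned to the number of experts and to any smoothness. -/
theorem Family.exists_law (fam : Family) {n : ℕ} (hn : 1 ≤ n) {η : ℝ} (hη : 0 < η) :
    ∃ a b, fam.Admissible a b ∧ IsSmoothLaw (fam.dist a b) η ∧
      -(∫ x, x ∂(fam.dist a b)) - ftplPotential (n + 1) (fam.dist a b) 0
        ≤ 512 * Real.log (n + 1 : ℕ) / η := by
  have hlog := two_thirds_le_log_succ hn
  have hexp : (2 * Real.log (n + 1 : ℕ) + 32) / η ≤ 512 * Real.log (n + 1 : ℕ) / η := by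
    gcongr
    linarith
  -- A shape of order `log N` keeps `N ^ (2 / α) ≤ exp 2` bounded; the scale is then fixed by `4 α /
  -- σ = η`.
  set α := 2 + Real.log (n + 1 : ℕ) with hα
  set σ := 4 * α / η with hσ
  have hα2 : 2 ≤ α := by linarith
  have hσ0 : 0 < σ := by positivity
  have hη' : 4 * α / σ = η := by rw [hσ]; field_simp
  have hpow : 4 * σ * ((n + 1 : ℕ) : ℝ) ^ (2 / α) ≤ 512 * Real.log (n + 1 : ℕ) / η := by
    have h8 : ((n + 1 : ℕ) : ℝ) ^ (2 / α) ≤ 8 := by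
      rw [Real.rpow_def_of_pos (by positivity)]
      calc Real.exp (Real.log (n + 1 : ℕ) * (2 / α)) ≤ Real.exp 2 := by
            refine Real.exp_le_exp.2 ?_
            rw [mul_div_assoc', div_le_iff₀ (by linarith)]
            linarith
        _ = Real.exp 1 * Real.exp 1 := by rw [← Real.exp_add]; norm_num
        _ ≤ 8 := by nlinarith [Real.exp_one_lt_d9, Real.exp_pos 1]
    calc 4 * σ * ((n + 1 : ℕ) : ℝ) ^ (2 / α) ≤ 4 * σ * 8 := by gcongr
      _ = 128 * α / η := by rw [hσ]; ring
      -- `128 α = 256 + 128 log N ≤ 512 log N` is exactly `log N ≥ 2/3`.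
      _ ≤ _ := div_le_div_of_nonneg_right (by linarith) hη.le
  cases fam with
  | gamma =>
    obtain ⟨h1, h2⟩ := exists_law_exponential hη
    exact ⟨1, η, ⟨one_pos, hη⟩, h1, (h2 n).trans hexp⟩
  | gumbel =>
    obtain ⟨h1, h2⟩ := exists_law_gumbel hη
    exact ⟨0, η⁻¹, inv_pos.2 hη, h1, (h2 n).trans hexp⟩
  | frechet =>
    obtain ⟨h1, h2⟩ := exists_law_frechet hα2 hσ0
    exact ⟨α, σ, ⟨by linarith, hσ0⟩, hη' ▸ h1, (h2 n).trans hpow⟩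
  | weibull =>
    obtain ⟨h1, h2⟩ := exists_law_exponential hη
    rw [← weibullMeasure_one] at h1 h2
    exact ⟨η⁻¹, 1, ⟨inv_pos.2 hη, one_pos⟩, h1, (h2 n).trans hexp⟩
  | pareto =>
    obtain ⟨h1, h2⟩ := exists_law_pareto hα2 hσ0
    exact ⟨σ, α, ⟨hσ0, by linarith⟩, hη' ▸ h1, (h2 n).trans hpow⟩

/-! ### Tuning -/

theorem expectedRegret_zero {n K : ℕ} (Φ : (Fin (n + 1) → ℝ) → ℝ) (ρ : ℝ)
    (E : ℕ → Fin (n + 1) → Fin K) (ℓ : ℕ → Fin K → ℝ) : expectedRegret Φ ρ E ℓ 0 = 0 := by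
  simp [expectedRegret, expectedLoss, bestLoss]

theorem Family.regret_le_sqrt (fam : Family) {K n T : ℕ} (hK : 0 < K) :
    ∃ a b : ℝ, fam.Admissible a b ∧ IsValidPerturbation (n + 1) (fam.dist a b) ∧
      ∀ (E : ℕ → Fin (n + 1) → Fin K) (ℓ : ℕ → Fin K → ℝ),
        (∀ t j, ℓ t j ∈ Set.Icc (0 : ℝ) 1) →
        expectedRegret (ftplPotential (n + 1) (fam.dist a b)) 0 E ℓ T
          ≤ 513 * Real.sqrt (K * T * Real.log (n + 1 : ℕ)) := by
  -- For one expert `log N = 0`, so the bound is `0` and the generic estimate, which needs `log N ≥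
  -- 2/3`, does not apply.
  rcases Nat.eq_zero_or_pos n with rfl | hn
  · obtain ⟨a, b, hab, hD, -⟩ := fam.exists_law le_rfl one_pos
    refine ⟨a, b, hab, hD.isValidPerturbation, fun E ℓ _ => ?_⟩
    rw [expectedRegret_single (grad_ftplPotential_mem hD) le_rfl (by simp) hK]
    positivity
  rcases Nat.eq_zero_or_pos T with rfl | hT
  · obtain ⟨a, b, hab, hD, -⟩ := fam.exists_law hn one_pos
    refine ⟨a, b, hab, hD.isValidPerturbation, fun E ℓ _ => ?_⟩
    rw [expectedRegret_zero]
    positivity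
  have hlog := two_thirds_le_log_succ hn
  set x := Real.log (n + 1 : ℕ) with hx
  have hKT : (0 : ℝ) < K * T := by positivity
  have hx0 : 0 < x := by linarith
  set S := Real.sqrt (K * T * x) with hS
  have hS0 : 0 < S := Real.sqrt_pos.2 (by positivity)
  have hS2 : S ^ 2 = K * T * x := Real.sq_sqrt (by positivity)
  -- This `η = √(log N / (K T))` makes both `log N / η` and `η K T` equal to `S`.
  have hη : 0 < S / (K * T) := by positivity
  obtain ⟨a, b, hab, hD, hR⟩ := fam.exists_law hn hη
  refine ⟨a, b, hab, hD.isValidPerturbation, fun E ℓ hℓ => ?_⟩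
  have h := expectedRegret_le hD hη.le E ℓ hℓ T
  rw [← hx] at hR
  have e1 : 512 * x / (S / (K * T)) = 512 * S := by
    field_simp
    linarith
  have e2 : S / (K * T) / 2 * K * T = S / 2 := by field_simp
  rw [e1] at hR
  rw [e2] at h
  linarith

/-- Clipping at `γ / K` with a law of smoothness `γ ^ 2 / K`. -/
theorem Family.regret_le_of_clip (fam : Family) {K n : ℕ} (hK : 0 < K) (hn : 1 ≤ n) {γ : ℝ}
    (hγ : 0 < γ) (hγ2 : γ ≤ 1 / 2) :
    ∃ a b ρ : ℝ, fam.Admissible a b ∧ 0 < ρ ∧ ρ < 1 / K ∧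
      IsValidPerturbation (n + 1) (fam.dist a b) ∧
      ∀ (T : ℕ) (E : ℕ → Fin (n + 1) → Fin K) (ℓ : ℕ → Fin K → ℝ),
        (∀ t j, ℓ t j ∈ Set.Icc (0 : ℝ) 1) → 0 ≤ bestLoss E ℓ T →
        expectedRegret (ftplPotential (n + 1) (fam.dist a b)) ρ E ℓ T
          ≤ 6 * γ * bestLoss E ℓ T + 2048 * (K * Real.log (n + 1 : ℕ)) / γ ^ 2 := by
  have hlog := two_thirds_le_log_succ hn
  have hK0 : (0 : ℝ) < K := by exact_mod_cast hK
  have hη : 0 < γ ^ 2 / K := by positivity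
  have hρ : 0 < γ / K := by positivity
  have hKρ : K * (γ / K) = γ := by field_simp
  obtain ⟨a, b, hab, hD, hR⟩ := fam.exists_law hn hη
  refine ⟨a, b, γ / K, hab, hρ, by gcongr; linarith, hD.isValidPerturbation,
    fun T E ℓ hℓ hL => ?_⟩
  have h := mul_expectedLoss_le hD hη.le hρ (by rw [hKρ]; linarith) (by
    rw [mul_div_assoc', div_le_div_iff_of_pos_right hK0]; nlinarith) E ℓ hℓ T
  have e1 : γ ^ 2 / K / (2 * (γ / K)) = γ / 2 := by field_simp
  have e2 : 512 * Real.log (n + 1 : ℕ) / (γ ^ 2 / K)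
      = 512 * (K * Real.log (n + 1 : ℕ) / γ ^ 2) := by field_simp
  rw [e1, hKρ] at h
  rw [e2] at hR
  rw [expectedRegret]
  set A := expectedLoss (ftplPotential (n + 1) (fam.dist a b)) (γ / K) E ℓ T
  set L := bestLoss E ℓ T
  set B := K * Real.log (n + 1 : ℕ) / γ ^ 2
  have hB : 0 ≤ B := by positivity
  have h1 : (1 - γ / 2) * (1 - γ) * A ≤ L + 512 * B := by linarith
  -- `1 + 6 γ` dominates the inverse of the loss factor for `γ ≤ 1/2`; being at most `4`, it turns
  -- `512` into `2048`.
  have hκ : 1 ≤ (1 - γ / 2) * (1 - γ) * (1 + 6 * γ) := by nlinarith [mul_pos hγ hγ]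
  have hκ0 : 0 < (1 - γ / 2) * (1 - γ) := mul_pos (by linarith) (by linarith)
  have h2 : A ≤ (1 + 6 * γ) * (L + 512 * B) := by
    refine le_of_mul_le_mul_left (h1.trans ?_) hκ0
    rw [← mul_assoc]
    exact le_mul_of_one_le_left (by positivity) hκ
  have h3 : γ * B ≤ 1 / 2 * B := by gcongr
  have e3 : 2048 * (K * Real.log (n + 1 : ℕ)) / γ ^ 2 = 2048 * B := by
    simp only [B]; ring
  rw [e3]
  linarith

theorem Family.regret_le_cbrt (fam : Family) {K n : ℕ} (hK : 0 < K) {L : ℝ} (hL : 0 ≤ L) :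
    ∃ a b ρ : ℝ, fam.Admissible a b ∧ 0 < ρ ∧ ρ < 1 / (K : ℝ) ∧
      IsValidPerturbation (n + 1) (fam.dist a b) ∧
      ∀ (T : ℕ) (E : ℕ → Fin (n + 1) → Fin K) (ℓ : ℕ → Fin K → ℝ),
        (∀ t j, ℓ t j ∈ Set.Icc (0 : ℝ) 1) → bestLoss E ℓ T = L →
        expectedRegret (ftplPotential (n + 1) (fam.dist a b)) ρ E ℓ T
          ≤ 9000 * (((K : ℝ) * Real.log (n + 1 : ℕ)) ^ (1 / 3 : ℝ) * L ^ (2 / 3 : ℝ)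
            + K * Real.log (n + 1 : ℕ)) := by
  have hK0 : (0 : ℝ) < K := by exact_mod_cast hK
  rcases Nat.eq_zero_or_pos n with rfl | hn
  · obtain ⟨a, b, hab, hD, -⟩ := fam.exists_law le_rfl one_pos
    have hKρ : K * (1 / 2 / K : ℝ) = 1 / 2 := by field_simp
    refine ⟨a, b, 1 / 2 / K, hab, by positivity, by gcongr; norm_num, hD.isValidPerturbation,
      fun T E ℓ _ _ => ?_⟩
    rw [expectedRegret_single (grad_ftplPotential_mem hD) (by positivity)
      (by rw [hKρ]; norm_num) hK]
    simp
  have hlog := two_thirds_le_log_succ hn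
  set M := K * Real.log (n + 1 : ℕ) with hM
  have hM0 : 0 < M := by positivity
  -- The balancing choice `γ = (M / L) ^ (1/3)` is at most `1/2` when `L ≥ 8 M`. For smaller `L`, `γ
  -- = 1/2` gives at most `3 L + 8192 M ≤ 9000 M`.
  rcases le_or_gt L (8 * M) with hLM | hLM
  · obtain ⟨a, b, ρ, hab, hρ, hρK, hval, h⟩ := fam.regret_le_of_clip hK hn
      (by norm_num : (0 : ℝ) < 1 / 2) le_rfl
    refine ⟨a, b, ρ, hab, hρ, hρK, hval, fun T E ℓ hℓ hb => ?_⟩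
    have h1 := h T E ℓ hℓ (hb ▸ hL)
    rw [hb, ← hM] at h1
    have h2 : 0 ≤ M ^ (1 / 3 : ℝ) * L ^ (2 / 3 : ℝ) := by positivity
    have e : 2048 * M / (1 / 2) ^ 2 = 8192 * M := by ring
    rw [e] at h1
    linarith
  · have hL0 : 0 < L := by linarith
    set m := M ^ (1 / 3 : ℝ) with hm
    set l := L ^ (1 / 3 : ℝ) with hl
    have hm0 : 0 < m := by positivity
    have hl0 : 0 < l := by positivity
    have hm3 : m ^ 3 = M := by
      rw [hm, ← Real.rpow_natCast, ← Real.rpow_mul hM0.le]; norm_num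
    have hl3 : l ^ 3 = L := by
      rw [hl, ← Real.rpow_natCast, ← Real.rpow_mul hL0.le]; norm_num
    have hl2 : L ^ (2 / 3 : ℝ) = l ^ 2 := by
      rw [hl, ← Real.rpow_natCast, ← Real.rpow_mul hL0.le]; norm_num
    have hml : m / l ≤ 1 / 2 := by
      have : 2 * m ≤ l := by
        refine le_of_pow_le_pow_left₀ three_ne_zero hl0.le ?_
        rw [mul_pow, hm3, hl3]
        linarith
      rw [div_le_iff₀ hl0]
      linarith
    obtain ⟨a, b, ρ, hab, hρ, hρK, hval, h⟩ := fam.regret_le_of_clip hK hn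
      (by positivity : 0 < m / l) hml
    refine ⟨a, b, ρ, hab, hρ, hρK, hval, fun T E ℓ hℓ hb => ?_⟩
    have h1 := h T E ℓ hℓ (hb ▸ hL)
    rw [hb, ← hM, ← hm3, ← hl3] at h1
    rw [hl2]
    have e1 : 6 * (m / l) * l ^ 3 = 6 * (m * l ^ 2) := by field_simp
    have e2 : 2048 * m ^ 3 / (m / l) ^ 2 = 2048 * (m * l ^ 2) := by field_simp
    rw [e1, e2] at h1
    have h2 : 0 < m * l ^ 2 := by positivity
    linarith

end BanditsWithExperts

theorem theorem4 (fam : BanditsWithExperts.Family) :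
    ∃ C : ℝ,
      (∀ K N T : ℕ, 0 < K → 0 < N →
        ∃ a b : ℝ, fam.Admissible a b ∧
          BanditsWithExperts.IsValidPerturbation N (fam.dist a b) ∧
          ∀ (E : ℕ → Fin N → Fin K) (ℓ : ℕ → Fin K → ℝ),
            (∀ t j, ℓ t j ∈ Set.Icc (0 : ℝ) 1) →
            BanditsWithExperts.expectedRegret
                (BanditsWithExperts.ftplPotential N (fam.dist a b)) 0 E ℓ T ≤
              C * Real.sqrt ((K : ℝ) * (T : ℝ) * Real.log (N : ℝ))) ∧
      (∀ K N : ℕ, 0 < K → 0 < N → ∀ L : ℝ, 0 ≤ L →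
        ∃ a b ρ : ℝ, fam.Admissible a b ∧ 0 < ρ ∧ ρ < 1 / (K : ℝ) ∧
          BanditsWithExperts.IsValidPerturbation N (fam.dist a b) ∧
          ∀ (T : ℕ) (E : ℕ → Fin N → Fin K) (ℓ : ℕ → Fin K → ℝ),
            (∀ t j, ℓ t j ∈ Set.Icc (0 : ℝ) 1) →
            BanditsWithExperts.bestLoss E ℓ T = L →
            BanditsWithExperts.expectedRegret
                (BanditsWithExperts.ftplPotential N (fam.dist a b)) ρ E ℓ T ≤
              C * (((K : ℝ) * Real.log (N : ℝ)) ^ (1 / 3 : ℝ) * L ^ (2 / 3 : ℝ)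
                + (K : ℝ) * Real.log (N : ℝ))) := by
  refine ⟨9000, fun K N T hK hN => ?_, fun K N hK hN L hL => ?_⟩
  · obtain ⟨n, rfl⟩ := Nat.exists_eq_succ_of_ne_zero hN.ne'
    obtain ⟨a, b, hab, hval, h⟩ := fam.regret_le_sqrt (n := n) (T := T) hK
    refine ⟨a, b, hab, hval, fun E ℓ hℓ => (h E ℓ hℓ).trans ?_⟩
    exact mul_le_mul_of_nonneg_right (by norm_num) (Real.sqrt_nonneg _)
  · obtain ⟨n, rfl⟩ := Nat.exists_eq_succ_of_ne_zero hN.ne'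
    exact fam.regret_le_cbrt hK hL
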